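/- **Setting.** Let $M=(\mathcal S,\mathcal A,\{\mathbb P_h\},\{r_h\},H)$, $H\ge 1$, be an episodic MDP with fixed initial state $s_1$, Markov transition kernels $\mathbb P_h(\cdot\mid s,a)$ and bounded measurable rewards $r_h(s,a)\ge 0$ such that $\sum_{h=1}^H r_h(s_h,a_h)\in[0,1]$ along every possible trajectory. Policies are deterministic (measurable) and Markov; $V_h^\pi,Q_h^\pi$ are the expected sums of rewards from step $h$ on, $V_h^*=\sup_\pi V_h^\pi$, $Q_h^*=\sup_\pi Q_h^\pi$. Let $\mathcal F\subseteq\mathcal G$ be hypothesis classes. Each $f\in\mathcal F$ carries functions $Q_{h,f}$, its greedy policy $\pi_{h,f}(s)\in\arg\max_a Q_{h,f}(s,a)$ and $V_{h,f}(s)=Q_{h,f}(s,\pi_{h,f}(s))$, $V_{H+1,f}=0$, where $V_{h,f}(s_h)$ is integrable under $\pi_f$. Realizability: there is $f^*\in\mathcal F$ with $Q_{h,f^*}=Q_h^*$ for all $h$. Let $\mathcal V$ be a class of real functions of $(s,a,s')$ (discriminators), and let $\ell_{h,f'}(o,f,g,v)\in\mathbb R^d$ be defined for $h\in[H]$, $f',f\in\mathcal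 F$, $g\in\mathcal G$, $v\in\mathcal V$ and $o=(s,a,s')$; the dependence on $f$ and $g$ may be through $f_{h+1}$ and $g_h$ only. Write $o_h=(s_h,a_h,s_{h+1})$ and $\mathbb E_{s_{h+1}}$ for the expectation over $s_{h+1}\sim\mathbb P_h(\cdot\mid s_h,a_h)$. **Assumptions.** 1. *(Decomposable estimation function.)* $\|\ell\|_2\le R$. There is $\mathcal T:\mathcal F\to\mathcal G$ with $\mathcal T(f^*)=f^*$ and $$\ell_{h,f'}(o_h,f,g,v)-\mathbb E_{s_{h+1}}[\ell_{h,f'}(o_h,f,g,v)]=\ell_{h,f'}(o_h,f,\mathcal T(f),v)$$ for all $h,f',f,g,v$ and all possible $o_h$. For all $f\in\mathcal F$ and $h$ there is $v_h^*(f)\in\mathcal V$ such that $v=v_h^*(f)$ maximizes $\|\mathbb E_{s_{h+1}}[\ell_{h,f'}(o_h,f,f,v)]\|$ over $\mathcal V$ simultaneously for all $f'\in\mathcal F$ and all $(s_h,a_h)$. 2. *(Lipschitz.)* For some $L>0$ and a distance $\rho$ on hypotheses, $\ell$ is $L$-Lipschitz, uniformly in $o$ and $h$, separately in $f$, $g$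 and $f'$ (with respect to $\rho$) and in $v$ (with respect to $\|\cdot\|_\infty$). 3. *(Q-type ABC class.)* The coupling functions $G_h:\mathcal F\times\mathcal F\to\mathbb R$ and $\kappa\in(0,1]$ satisfy, for all $h$ and $f,g\in\mathcal F$, $$\sup_{v\in\mathcal V}\mathbb E_{s_h,a_h\sim\pi_g}\big\|\mathbb E_{s_{h+1}}[\ell_{h,g}(o_h,f,f,v)]\big\|^2\ge G_h(f,g)^2,$$ $$\kappa\,\big|\mathbb E_{\pi_f}[Q_{h,f}(s_h,a_h)-r_h(s_h,a_h)-V_{h+1,f}(s_{h+1})]\big|\le|G_h(f,f)|.$$ **Complexities.** $\dim_{\mathrm{FE}}(\mathcal F,G,\epsilon)$ is the maximum over $h$ of the length of the longest sequence $f_1,\dots,f_n\in\mathcal F$ such that for some $\epsilon'\ge\epsilon$ and every $2\le t\le n$ there is $g\in\mathcal F$ with $\sqrt{\sum_{i<t}G_h(g,f_i)^2}\le\epsilon'<|G_h(g,f_t)|$. $N_{\mathcal L}(\epsilon)$ is the sup-norm $\epsilon$-covering number of the induced class of functions $(f',o)\mapsto\ell_{h,f'}(o,f,g,v)$ on $\mathcal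 F\times(\mathcal S\times\mathcal A\times\mathcal S)$, indexed by $(h,f,g,v)\in[H]\times\mathcal F\times\mathcal G\times\mathcal V$. **Algorithm (OPERA, on-policy, radius $\beta$).** In episode $t=1,\dots,T$ choose, from the past, $f^t$ maximizing $Q_{1,f}(s_1,\pi_{1,f}(s_1))$ over all $f\in\mathcal F$ such that for every $h\in[H]$ $$\sup_{v\in\mathcal V}\Big\{\sum_{i<t}\|\ell_{h,f^i}(o_h^i,f,f,v)\|^2-\inf_{g\in\mathcal G}\sum_{i<t}\|\ell_{h,f^i}(o_h^i,f,g,v)\|^2\Big\}\le\beta$$ (an arbitrary $f^t\in\mathcal F$ if there is no such $f$), play $\pi^t=\pi_{f^t}$ for one episode, and record $o_h^t=(s_h^t,a_h^t,s_{h+1}^t)$ for all $h$. **Theorem (Regret bound of OPERA).** For every $R>0$ there are constants $c_0,C>0$, depending only on $R$, such that the following holds under the assumptions above. Let $T\ge 2$ and $\delta\in(0,1)$, suppose that $N_{\mathcal L}(1/T)$ and $\dim_{\mathrm{FE}}(\mathcal F,G,\sqrt{1/T})$ are finite, and run OPERA for $T$ episodes with any $\beta\ge c_0\log\big(TH\,N_{\mathcal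 L}(1/T)/\delta\big)$. Then with probability at least $1-\delta$, $$\mathrm{Regret}(T)=\sum_{t=1}^T\big(V_1^*(s_1)-V_1^{\pi^t}(s_1)\big)\le C\,\frac H\kappa\sqrt{T\cdot\dim_{\mathrm{FE}}\big(\mathcal F,G,\sqrt{1/T}\big)\cdot\beta}.$$ -/

import Mathlib

open MeasureTheory ProbabilityTheory

/-- A finite-horizon episodic MDP with horizon `H` and steps indexed by `Fin H`: transition kernels,
deterministic rewards `r_h(s, a) ≥ 0`, and a fixed initial state.  The normalisation of the total
reward is `MDP.Normalized` below; `reward_bdd` only makes values at unreachable states finite. -/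
structure MDP (S A : Type*) [MeasurableSpace S] [MeasurableSpace A] (H : ℕ) where
  trans : Fin H → Kernel (S × A) S
  markov : ∀ h, IsMarkovKernel (trans h)
  reward : Fin H → S → A → ℝ
  measurable_reward : ∀ h, Measurable (fun p : S × A => reward h p.1 p.2)
  reward_nonneg : ∀ h s a, 0 ≤ reward h s a
  reward_bdd : ∃ B : ℝ, ∀ h s a, reward h s a ≤ B
  init : S

/-- A deterministic policy `π = (π_h)`. -/
structure Policy (S A : Type*) [MeasurableSpace S] [MeasurableSpace A] (H : ℕ) where
  act : Fin H → S → A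
  measurable_act : ∀ h, Measurable (act h)

namespace MDP

variable {S A : Type*} [MeasurableSpace S] [MeasurableSpace A] {H : ℕ}

/-- One step of the state process under `π`; after the horizon the state is frozen. -/
noncomputable def step (M : MDP S A H) (π : Policy S A H) (n : ℕ) : Kernel S S :=
  if hn : n < H then
    (M.trans ⟨n, hn⟩).comap (fun s => (s, π.act ⟨n, hn⟩ s))
      (measurable_id.prodMk (π.measurable_act ⟨n, hn⟩))
  else Kernel.id

instance (M : MDP S A H) (π : Policy S A H) (n : ℕ) : IsMarkovKernel (M.step π n) := by
  unfold step
  split_ifs with hn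
  · have := M.markov ⟨n, hn⟩
    infer_instance
  · infer_instance

/-- The same step, as a kernel from the history of states. -/
noncomputable def histStep (M : MDP S A H) (π : Policy S A H) (n : ℕ) :
    Kernel ((i : Finset.Iic n) → (fun _ : ℕ => S) i) ((fun _ : ℕ => S) (n + 1)) :=
  (M.step π n).comap (fun x => x ⟨n, Finset.mem_Iic.2 le_rfl⟩) (measurable_pi_apply _)

instance (M : MDP S A H) (π : Policy S A H) (n : ℕ) : IsMarkovKernel (M.histStep π n) := by
  unfold histStep
  infer_instance

/-- Law of the state process under `π`, started at step `n` from the state `s`: coordinate `k ≥ n`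
of the path is the state at step `k` (the coordinates before `n` are filled with `s`). -/
noncomputable def stateLaw (M : MDP S A H) (π : Policy S A H) (n : ℕ) (s : S) :
    Measure (ℕ → S) :=
  Kernel.traj (X := fun _ => S) (M.histStep π) n (fun _ => s)

/-- Law of the states `(s_1, …, s_{H+1})` of one episode under `π`, from the initial state. -/
noncomputable def episodeLaw (M : MDP S A H) (π : Policy S A H) : Measure (Fin (H + 1) → S) :=
  (M.stateLaw π 0 M.init).map (fun x i => x i)

/-- `V_h^π(s)`: expected sum of the rewards from step `n` on, given that the state at step `n`
is `s`. -/
noncomputable def value (M : MDP S A H) (π : Policy S A H) (n : ℕ) (s : S) : ℝ :=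
  ∫ x, ∑ k : Fin H, (if n ≤ k then M.reward k (x k) (π.act k (x k)) else 0) ∂(M.stateLaw π n s)

/-- `Q_h^π(s, a)`: take `a` at `s` at step `h`, and follow `π` afterwards. -/
noncomputable def qvalue (M : MDP S A H) (π : Policy S A H) (h : Fin H) (s : S) (a : A) : ℝ :=
  M.reward h s a + ∫ s', M.value π (h + 1) s' ∂(M.trans h (s, a))

/-- `V_h^*(s)`, the best value over all policies. -/
noncomputable def optValue (M : MDP S A H) (n : ℕ) (s : S) : ℝ :=
  ⨆ π : Policy S A H, M.value π n s

/-- `Q_h^*(s, a)`, the best action-value over all policies. -/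
noncomputable def optQ (M : MDP S A H) (h : Fin H) (s : S) (a : A) : ℝ :=
  ⨆ π : Policy S A H, M.qvalue π h s a

/-- Along every possible trajectory the total reward lies in `[0, 1]`. -/
def Normalized (M : MDP S A H) : Prop :=
  ∀ π : Policy S A H, ∀ᵐ x ∂(M.episodeLaw π),
    ∑ h : Fin H, M.reward h (x h.castSucc) (π.act h (x h.castSucc)) ≤ 1

end MDP

/-- The hypothesis classes `𝓕 ⊆ 𝓖` (sets of hypotheses in an ambient type `Hyp`).  Every hypothesis
`f` carries action-value functions `Q_{h,f}` and its greedy policy `π_f`. -/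
structure HypClasses (S A Hyp : Type*) [MeasurableSpace S] [MeasurableSpace A]
    [MeasurableSpace Hyp] (H : ℕ) where
  F : Set Hyp
  G : Set Hyp
  subset : F ⊆ G
  Q : Hyp → Fin H → S → A → ℝ
  measurable_Q : ∀ f ∈ F, ∀ h, Measurable (fun p : S × A => Q f h p.1 p.2)
  greedy : Hyp → Policy S A H
  greedy_max : ∀ f ∈ F, ∀ h s a, Q f h s a ≤ Q f h s ((greedy f).act h s)
  measurable_greedy : ∀ h, Measurable (fun p : F × S => (greedy p.1).act h p.2)

namespace HypClasses

variable {S A Hyp : Type*} [MeasurableSpace S] [MeasurableSpace A] [MeasurableSpace Hyp] {H : ℕ}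

/-- `V_{h,f}(s) = Q_{h,f}(s, π_{h,f}(s)) = max_a Q_{h,f}(s, a)`, and `V_{H+1,f} = 0`. -/
noncomputable def V (𝒞 : HypClasses S A Hyp H) (f : Hyp) (n : ℕ) (s : S) : ℝ :=
  if hn : n < H then 𝒞.Q f ⟨n, hn⟩ s ((𝒞.greedy f).act ⟨n, hn⟩ s) else 0

/-- Under its own policy, every hypothesis has integrable value estimates (so that its expected
Bellman errors exist). -/
def IntegrableValues (𝒞 : HypClasses S A Hyp H) (M : MDP S A H) : Prop :=
  ∀ f ∈ 𝒞.F, ∀ h : Fin H,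
    Integrable (fun x : Fin (H + 1) → S => 𝒞.V f h (x h.castSucc)) (M.episodeLaw (𝒞.greedy f))

/-- `fstar` is an optimal hypothesis of the class: `Q_{h, f*} = Q_h^*`. -/
def IsOptimalHyp (𝒞 : HypClasses S A Hyp H) (M : MDP S A H) (fstar : Hyp) : Prop :=
  fstar ∈ 𝒞.F ∧ ∀ h s a, 𝒞.Q fstar h s a = M.optQ h s a

end HypClasses

/-- Estimation functions `ℓ_{h,f'}(o, f, g, v)` with values in `ℝ^d`, written `ℓ h f' o f g v`, where
`o = (s_h, a_h, s_{h+1})`.  The function may depend on all of `f` and `g`, in particular it may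
depend on `f_{h+1}` and `g_h` only. -/
abbrev EstFun (S A Hyp : Type*) (H d : ℕ) : Type _ :=
  Fin H → Hyp → S × A × S → Hyp → Hyp → (S × A × S → ℝ) → EuclideanSpace ℝ (Fin d)

section Estimation

variable {S A Hyp : Type*} [MeasurableSpace S] [MeasurableSpace A] [MeasurableSpace Hyp]
  {H d : ℕ}

/-- `E_{s_{h+1}} [ ℓ_{h,f'}(o_h, f, g, v) | s_h = s, a_h = a ]`. -/
noncomputable def condMean (M : MDP S A H) (ℓ : EstFun S A Hyp H d) (h : Fin H) (f' f g : Hyp)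
    (v : S × A × S → ℝ) (s : S) (a : A) : EuclideanSpace ℝ (Fin d) :=
  ∫ s', ℓ h f' (s, a, s') f g v ∂(M.trans h (s, a))

/-- Decomposable estimation functions, with `‖ℓ‖ ≤ R`.  "All possible `o_h`" are all `(s, a)` and
almost all next states. -/
structure IsDEF (M : MDP S A H) (𝒞 : HypClasses S A Hyp H) (𝒱 : Set (S × A × S → ℝ))
    (fstar : Hyp) (ℓ : EstFun S A Hyp H d) (R : ℝ) : Prop where
  measurable : ∀ h, ∀ f ∈ 𝒞.F, ∀ g ∈ 𝒞.G, ∀ v ∈ 𝒱,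
    Measurable (fun p : 𝒞.F × (S × A × S) => ℓ h p.1 p.2 f g v)
  bounded : ∀ h, ∀ f' ∈ 𝒞.F, ∀ f ∈ 𝒞.F, ∀ g ∈ 𝒞.G, ∀ v ∈ 𝒱, ∀ o, ‖ℓ h f' o f g v‖ ≤ R
  decomposable : ∃ 𝒯 : Hyp → Hyp, (∀ f ∈ 𝒞.F, 𝒯 f ∈ 𝒞.G) ∧ 𝒯 fstar = fstar ∧
    ∀ h, ∀ f ∈ 𝒞.F, ∀ f' ∈ 𝒞.F, ∀ g ∈ 𝒞.G, ∀ v ∈ 𝒱, ∀ s a, ∀ᵐ s' ∂(M.trans h (s, a)),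
      ℓ h f' (s, a, s') f g v - condMean M ℓ h f' f g v s a = ℓ h f' (s, a, s') f (𝒯 f) v
  global_discriminator : ∀ f ∈ 𝒞.F, ∀ h, ∃ vstar ∈ 𝒱, ∀ f' ∈ 𝒞.F, ∀ v ∈ 𝒱, ∀ s a,
    ‖condMean M ℓ h f' f f v s a‖ ≤ ‖condMean M ℓ h f' f f vstar s a‖

/-- Lipschitz estimation functions, with constant `L`, where `ρ` measures the distance of two
hypotheses and discriminators are compared in the sup-norm (possibly infinite). -/
structure IsLipschitzEst (𝒞 : HypClasses S A Hyp H) (𝒱 : Set (S × A × S → ℝ))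
    (ρ : Hyp → Hyp → ℝ) (ℓ : EstFun S A Hyp H d) (L : ℝ) : Prop where
  fst : ∀ h, ∀ f' ∈ 𝒞.F, ∀ f ∈ 𝒞.F, ∀ g ∈ 𝒞.G, ∀ v ∈ 𝒱, ∀ f₂ ∈ 𝒞.F, ∀ o,
    ‖ℓ h f' o f g v - ℓ h f' o f₂ g v‖ ≤ L * ρ f f₂
  snd : ∀ h, ∀ f' ∈ 𝒞.F, ∀ f ∈ 𝒞.F, ∀ g ∈ 𝒞.G, ∀ v ∈ 𝒱, ∀ g₂ ∈ 𝒞.G, ∀ o,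
    ‖ℓ h f' o f g v - ℓ h f' o f g₂ v‖ ≤ L * ρ g g₂
  discriminator : ∀ h, ∀ f' ∈ 𝒞.F, ∀ f ∈ 𝒞.F, ∀ g ∈ 𝒞.G, ∀ v ∈ 𝒱, ∀ v₂ ∈ 𝒱, ∀ o,
    ‖ℓ h f' o f g v - ℓ h f' o f g v₂‖ₑ ≤ ENNReal.ofReal L * ⨆ o', ‖v o' - v₂ o'‖ₑ
  sub : ∀ h, ∀ f' ∈ 𝒞.F, ∀ f ∈ 𝒞.F, ∀ g ∈ 𝒞.G, ∀ v ∈ 𝒱, ∀ f'₂ ∈ 𝒞.F, ∀ o,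
    ‖ℓ h f' o f g v - ℓ h f'₂ o f g v‖ ≤ L * ρ f' f'₂

/-- `G_{h,f*}` is an admissible Bellman characterization with constant `κ`, of Q-type
(`π_op = π_g`): the dominating average estimation function and Bellman dominance. -/
structure IsABC (M : MDP S A H) (𝒞 : HypClasses S A Hyp H) (𝒱 : Set (S × A × S → ℝ))
    (ℓ : EstFun S A Hyp H d) (Gc : Fin H → Hyp → Hyp → ℝ) (κ : ℝ) : Prop where
  dominating : ∀ h, ∀ f ∈ 𝒞.F, ∀ g ∈ 𝒞.F,
    (Gc h f g) ^ 2 ≤ ⨆ v : 𝒱, ∫ x : Fin (H + 1) → S,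
      ‖condMean M ℓ h g f f v (x h.castSucc) ((𝒞.greedy g).act h (x h.castSucc))‖ ^ 2
        ∂(M.episodeLaw (𝒞.greedy g))
  bellman_dominance : ∀ h : Fin H, ∀ f ∈ 𝒞.F,
    κ * |∫ x : Fin (H + 1) → S,
      (𝒞.Q f h (x h.castSucc) ((𝒞.greedy f).act h (x h.castSucc))
        - M.reward h (x h.castSucc) ((𝒞.greedy f).act h (x h.castSucc))
        - 𝒞.V f (h + 1) (x h.succ)) ∂(M.episodeLaw (𝒞.greedy f))| ≤ |Gc h f f|

/-- Covering number, in the sup-norm, of the induced class of estimation functions: the members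
are indexed by `(h, f, g, v)`, and each is a function of the observation `o` and of the hypothesis
`f'` that collects the data. -/
noncomputable def coveringNumberEst (𝒞 : HypClasses S A Hyp H) (𝒱 : Set (S × A × S → ℝ))
    (ℓ : EstFun S A Hyp H d) (ε : ℝ) : ℕ∞ :=
  ⨅ (N : Set (Hyp → S × A × S → EuclideanSpace ℝ (Fin d)))
    (_ : ∀ h, ∀ f ∈ 𝒞.F, ∀ g ∈ 𝒞.G, ∀ v ∈ 𝒱, ∃ φ ∈ N, ∀ f' ∈ 𝒞.F, ∀ o,
      ‖ℓ h f' o f g v - φ f' o‖ ≤ ε), N.encard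

end Estimation

/-- There is a sequence of length `n` as in the definition of the functional eluder dimension. -/
def IsEluderLength {Hyp : Type*} (F : Set Hyp) (G : Hyp → Hyp → ℝ) (ε : ℝ) (n : ℕ) : Prop :=
  ∃ f : Fin n → Hyp, (∀ i, f i ∈ F) ∧ ∃ ε' : ℝ, ε ≤ ε' ∧ ∀ t : Fin n, 1 ≤ (t : ℕ) →
    ∃ g ∈ F, Real.sqrt (∑ i ∈ Finset.univ.filter (fun i => i < t), (G g (f i)) ^ 2) ≤ ε' ∧
      ε' < |G g (f t)|

/-- The functional eluder dimension of a sequence of coupling functions (maximum over `h`). -/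
noncomputable def feDim {Hyp : Type*} {H : ℕ} (F : Set Hyp) (Gc : Fin H → Hyp → Hyp → ℝ)
    (ε : ℝ) : ℕ∞ :=
  ⨆ (h : Fin H) (n : ℕ) (_ : IsEluderLength F (Gc h) ε n), (n : ℕ∞)

section Opera

variable {S A Hyp : Type*} [MeasurableSpace S] [MeasurableSpace A] [MeasurableSpace Hyp]
  {H d : ℕ}

/-- The observation `o_h = (s_h, a_h, s_{h+1})` of an episode with states `x` played with `π`. -/
def obs (π : Policy S A H) (x : Fin (H + 1) → S) (h : Fin H) : S × A × S :=
  (x h.castSucc, π.act h (x h.castSucc), x h.succ)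

/-- The confidence set of OPERA before episode `t` (counted from `0`), when the hypotheses `fs i`
were played and the states `xs i` were seen in the episodes `i < t`. -/
def confidenceSet (𝒞 : HypClasses S A Hyp H) (𝒱 : Set (S × A × S → ℝ)) (ℓ : EstFun S A Hyp H d)
    (β : ℝ) (fs : ℕ → Hyp) (xs : ℕ → Fin (H + 1) → S) (t : ℕ) : Set Hyp :=
  {f | f ∈ 𝒞.F ∧ ∀ h, ∀ v ∈ 𝒱,
    ∑ i ∈ Finset.range t, ‖ℓ h (fs i) (obs (𝒞.greedy (fs i)) (xs i) h) f f v‖ ^ 2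
      - ⨅ g : 𝒞.G, ∑ i ∈ Finset.range t,
          ‖ℓ h (fs i) (obs (𝒞.greedy (fs i)) (xs i) h) f g v‖ ^ 2 ≤ β}

/-- The processes `f t` (chosen hypothesis) and `x t` (states of the episode), `t < T`, are a run of
OPERA, on-policy, with radius `β`: `f t` is chosen from the past, episode `t` is played with the
greedy policy of `f t`, and `f t` maximizes `Q_{1,f}(s_1, π_f(s_1))` over the confidence set
(if this set happens to be empty, the choice is free). -/
structure IsOperaRun [NeZero H] (M : MDP S A H) (𝒞 : HypClasses S A Hyp H)
    (𝒱 : Set (S × A × S → ℝ)) (ℓ : EstFun S A Hyp H d) (β : ℝ) (T : ℕ)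
    {Ω : Type*} {mΩ : MeasurableSpace Ω} (μ : Measure Ω) (ℱ : Filtration ℕ mΩ)
    (f : ℕ → Ω → Hyp) (x : ℕ → Ω → Fin (H + 1) → S) : Prop where
  mem : ∀ t < T, ∀ ω, f t ω ∈ 𝒞.F
  measurable_hyp : ∀ t < T, Measurable[ℱ t] (f t)
  measurable_states : ∀ t < T, Measurable[ℱ (t + 1)] (x t)
  law : ∀ t < T, ∀ B : Set (Fin (H + 1) → S), MeasurableSet B →
    μ[(x t ⁻¹' B).indicator (fun _ => (1 : ℝ)) | ℱ t]
      =ᵐ[μ] fun ω => (M.episodeLaw (𝒞.greedy (f t ω))).real B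
  optimal : ∀ t < T, ∀ᵐ ω ∂μ,
    (confidenceSet 𝒞 𝒱 ℓ β (fun i => f i ω) (fun i => x i ω) t).Nonempty →
      f t ω ∈ confidenceSet 𝒞 𝒱 ℓ β (fun i => f i ω) (fun i => x i ω) t ∧
      ∀ f' ∈ confidenceSet 𝒞 𝒱 ℓ β (fun i => f i ω) (fun i => x i ω) t,
        𝒞.Q f' 0 M.init ((𝒞.greedy f').act 0 M.init)
          ≤ 𝒞.Q (f t ω) 0 M.init ((𝒞.greedy (f t ω)).act 0 M.init)

/-- `Regret(T) = ∑_t (V_1^*(s_1) - V_1^{π^t}(s_1))` when the hypotheses `fs t` are played. -/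
noncomputable def regret (M : MDP S A H) (𝒞 : HypClasses S A Hyp H) (T : ℕ) (fs : ℕ → Hyp) : ℝ :=
  ∑ t ∈ Finset.range T, (M.optValue 0 M.init - M.value (𝒞.greedy (fs t)) 0 M.init)

end Opera

/-! The proof combines optimism, concentration and an eluder pigeonhole. If f* lies in every
confidence set, then f^t promises at least V_1^*(s_1), so the regret of episode t is at most the gap
between the promised and the true value of π^t. This gap telescopes into the expected Bellman errors
of f^t under its own policy (`HypClasses.V_sub_value_eq_sum`), and Bellman dominance bounds each of
them by |G_h(f^t, f^t)| / κ.

It remains to sum these diagonal values, given that ∑_{i<t} G_h(f^t, f^i)² ≤ 8β for all t. For each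
ε above the threshold, the episodes with diagonal value larger than ε are sorted into about 8β/ε²
bins, each of which is an eluder sequence and so has at most d members
(`card_filter_le_of_isEluderLength`). Such a count at every level ε makes the sum of order √(dβT)
(`sum_le_of_card_filter_le`).

Both the membership of f* and the bound 8β come from one event: for all h, f, g, v, t, the past sum
of the mean squares E‖E_{s'} ℓ(f,g,v)‖² is at most 4 times the excess loss ∑‖ℓ(f,g,v)‖² -
∑‖ℓ(f,𝒯f,v)‖² plus a logarithmic term (`IsOperaRun.measure_exists_excess_le`). By decomposability
ℓ(f,g,v) is its conditional mean e plus the centred vector ℓ(f,𝒯f,v). The excess is therefore ‖e‖²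
plus a centred cross term linear in e, and by Hoeffding half of ‖e‖² pays for the cross term
(`lintegral_exp_sq_norm_sub_le`). A product supermartingale and a union bound over a cover give the
event.

At f*, 𝒯f* = f* and the mean squares are nonnegative, so no g beats f* by more than β. At f^t, the
hypothesis 𝒯f^t competes in the infimum of the constraint, so the excess is at most β; the global
discriminator, being the same for all data-collecting hypotheses, turns this into the bound on the
couplings. -/

/-! ### Counting by the eluder dimension -/

/-- If the number of `i` with `a i > ε` is at most `d (1 + B / ε²)` for all `ε ≥ w`, then the sum of
the `a i ∈ [0, R]` is small. -/
theorem sum_le_of_card_filter_le {ι : Type*} [DecidableEq ι] (a : ι → ℝ) (d : ℕ) {w R B : ℝ}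
    (hw : 0 < w) (s : Finset ι) (h0 : ∀ i ∈ s, 0 ≤ a i) (hR : ∀ i ∈ s, a i ≤ R)
    (hcard : ∀ ε, w ≤ ε → ((s.filter (fun i => ε < a i)).card : ℝ) ≤ d * (1 + B / ε ^ 2)) :
    ∑ i ∈ s, a i ≤ s.card * w + (min s.card d : ℕ) * R
      + 2 * √(B * d) * √((s.card - d : ℕ) : ℝ) := by
  -- Removing the minimum replaces sorting. All n + 1 values exceed every ε below the minimum, so
  -- the counting bound caps the minimum by max(w, √(Bd / (n + 1 - d))). While n + 1 ≤ d the count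
  -- says nothing and the minimum is bounded by R.
  induction hn : s.card generalizing s with
  | zero =>
    rw [Finset.card_eq_zero] at hn
    simp [hn]
  | succ n ih =>
    have hne : s.Nonempty := Finset.card_pos.1 (by omega)
    obtain ⟨m, hm, hmin⟩ := s.exists_min_image a hne
    have hcard' : (s.erase m).card = n := by rw [Finset.card_erase_of_mem hm, hn]; rfl
    have := ih (s.erase m) (fun i hi => h0 i (Finset.mem_of_mem_erase hi))
      (fun i hi => hR i (Finset.mem_of_mem_erase hi))
      (fun ε hε => le_trans (by
        exact_mod_cast Finset.card_le_card
          (Finset.filter_subset_filter _ (Finset.erase_subset _ _))) (hcard ε hε)) hcard'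
    rw [← Finset.add_sum_erase s a hm]
    have hR0 : 0 ≤ R := (h0 m hm).trans (hR m hm)
    rcases Nat.lt_or_ge d (n + 1) with hd | hd
    · have hsub : n + 1 - d = (n - d) + 1 := by omega
      have hmin1 : min (n + 1) d = min n d := by omega
      set k : ℕ := n - d
      have hk : ((n + 1 : ℕ) : ℝ) = d + (k + 1) := by
        have : n + 1 = d + (k + 1) := by omega
        rw [this]; push_cast; ring
      have hk1 : (0 : ℝ) < k + 1 := by positivity
      have key : a m ≤ max w (√(B * d) / √(k + 1)) := by
        by_contra! hlt
        obtain ⟨ε, hε1, hε2⟩ := exists_between hlt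
        have hwε : w < ε := (le_max_left _ _).trans_lt hε1
        have hbε : √(B * d) / √(k + 1) < ε := (le_max_right _ _).trans_lt hε1
        have hε0 : 0 < ε := hw.trans hwε
        have h1 := hcard ε hwε.le
        rw [Finset.filter_true_of_mem (fun i hi => hε2.trans_le (hmin i hi)), hn, hk] at h1
        have h2 : B * d / (k + 1) < ε ^ 2 := by
          rw [← Real.sqrt_div' _ hk1.le] at hbε
          exact (Real.sqrt_lt' hε0).1 hbε
        rw [div_lt_iff₀ hk1] at h2
        have h3 : (k + 1 : ℝ) ≤ B * d / ε ^ 2 := by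
          have : d * (1 + B / ε ^ 2) = d + B * d / ε ^ 2 := by ring
          linarith
        rw [le_div_iff₀ (by positivity)] at h3
        linarith
      have hmax : a m ≤ w + √(B * d) / √(k + 1) := by
        refine key.trans (max_le ?_ ?_)
        · have : 0 ≤ √(B * d) / √(k + 1) := by positivity
          linarith
        · linarith
      -- The bound 1/√(k+1) ≤ 2(√(k+1) - √k) makes the contributions telescope to the last term of
      -- the claim.
      have hsq : 1 / √((k : ℝ) + 1) ≤ 2 * (√((k : ℝ) + 1) - √k) := by
        have h1 : 0 < √((k : ℝ) + 1) := Real.sqrt_pos.2 hk1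
        rw [div_le_iff₀ h1]
        have h2 := Real.sq_sqrt hk1.le
        have h3 := Real.sq_sqrt (Nat.cast_nonneg k : (0 : ℝ) ≤ k)
        nlinarith [sq_nonneg (√((k : ℝ) + 1) - √k)]
      have h4 := mul_le_mul_of_nonneg_left hsq (Real.sqrt_nonneg (B * d))
      rw [hsub, hmin1]
      push_cast at this ⊢
      rw [mul_one_div] at h4
      linarith
    · have hsub : n + 1 - d = 0 := by omega
      have hsub' : n - d = 0 := by omega
      have hmin1 : min (n + 1) d = min n d + 1 := by omega
      rw [hsub'] at this
      rw [hsub, hmin1]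
      push_cast at this ⊢
      linarith [hR m hm]

/-- The elements of a sequence of hypotheses at which the coupling function exceeds `ε` can be
distributed into bins such that each is `ε`-independent of the earlier members of its bin. -/
theorem exists_bins {Hyp : Type*} (G : Hyp → Hyp → ℝ) (f : ℕ → Hyp) {ε B : ℝ}
    (K : ℕ) (hpos : 0 < K) (hK : B < K * ε ^ 2) (p : ℕ → Prop) [DecidablePred p] (T : ℕ)
    (hsum : ∀ t < T, ∑ i ∈ Finset.range t, (G (f t) (f i)) ^ 2 ≤ B) :
    ∃ b : ℕ → Fin K, ∀ t < T,
      ∑ i ∈ (Finset.range t).filter (fun i => p i ∧ b i = b t), (G (f t) (f i)) ^ 2 ≤ ε ^ 2 := by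
  induction T with
  | zero =>
    exact ⟨fun _ => ⟨0, hpos⟩, by simp⟩
  | succ T ih =>
    obtain ⟨b, hb⟩ := ih (fun t ht => hsum t (by omega))
    -- The bins are disjoint parts of the past of T, so if all K of them exceeded ε² the whole past
    -- would have sum at least Kε² > B.
    have : ∃ k : Fin K, ∑ i ∈ (Finset.range T).filter (fun i => p i ∧ b i = k),
        (G (f T) (f i)) ^ 2 ≤ ε ^ 2 := by
      by_contra! hcon
      have h1 := hsum T (by omega)
      have h2 : ∑ k : Fin K, ∑ i ∈ (Finset.range T).filter (fun i => p i ∧ b i = k),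
          (G (f T) (f i)) ^ 2 ≤ ∑ i ∈ Finset.range T, (G (f T) (f i)) ^ 2 := by
        rw [← Finset.sum_fiberwise (Finset.range T) b]
        refine Finset.sum_le_sum fun k _ => ?_
        refine Finset.sum_le_sum_of_subset_of_nonneg ?_ (fun _ _ _ => sq_nonneg _)
        intro i hi
        simp only [Finset.mem_filter] at hi ⊢
        exact ⟨hi.1, hi.2.2⟩
      have h3 : (K : ℝ) * ε ^ 2 ≤ ∑ k : Fin K,
          ∑ i ∈ (Finset.range T).filter (fun i => p i ∧ b i = k), (G (f T) (f i)) ^ 2 := by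
        calc (K : ℝ) * ε ^ 2 = ∑ _k : Fin K, ε ^ 2 := by simp
          _ ≤ _ := Finset.sum_le_sum fun k _ => (hcon k).le
      linarith
    obtain ⟨k, hk⟩ := this
    refine ⟨Function.update b T k, fun t ht => ?_⟩
    have hfilter : ∀ c : Fin K, (Finset.range t).filter
        (fun i => p i ∧ Function.update b T k i = c)
        = (Finset.range t).filter (fun i => p i ∧ b i = c) := by
      intro c
      refine Finset.filter_congr fun i hi => ?_
      rw [Function.update_of_ne]
      have := Finset.mem_range.1 hi
      omega
    rw [hfilter]
    rcases Nat.lt_succ_iff_lt_or_eq.1 ht with h | rfl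
    · rw [Function.update_of_ne h.ne]
      exact hb t h
    · rw [Function.update_self]
      exact hk

/-- Counting the large diagonal values of a coupling function by its eluder dimension. -/
theorem card_filter_le_of_isEluderLength {Hyp : Type*} {F : Set Hyp} {G : Hyp → Hyp → ℝ}
    {w ε B : ℝ} {d : ℕ} (hd : ∀ n, IsEluderLength F G w n → n ≤ d) (hw : 0 < w) (hε : w ≤ ε)
    (hB : 0 ≤ B) (f : ℕ → Hyp) (T : ℕ) (hf : ∀ t < T, f t ∈ F)
    (hsum : ∀ t < T, ∑ i ∈ Finset.range t, (G (f t) (f i)) ^ 2 ≤ B) :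
    (((Finset.range T).filter (fun t => ε < |G (f t) (f t)|)).card : ℝ)
      ≤ d * (1 + B / ε ^ 2) := by
  have hε0 : 0 < ε := hw.trans_le hε
  -- The least number of bins with B < Kε².
  set K : ℕ := ⌊B / ε ^ 2⌋₊ + 1
  have hK : B < K * ε ^ 2 := by
    rw [← div_lt_iff₀ (by positivity)]
    simpa [K] using Nat.lt_floor_add_one (B / ε ^ 2)
  obtain ⟨b, hb⟩ := exists_bins G f K (Nat.succ_pos _) hK (fun t => ε < |G (f t) (f t)|) T hsum
  set s := (Finset.range T).filter (fun t => ε < |G (f t) (f t)|) with hs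
  have hbin : ∀ k : Fin K, (s.filter (fun t => b t = k)).card ≤ d := by
    intro k
    set J := s.filter (fun t => b t = k) with hJ
    have hJmem : ∀ j ∈ J, j < T ∧ ε < |G (f j) (f j)| ∧ b j = k := by
      intro j hj
      simp only [hJ, hs, Finset.mem_filter, Finset.mem_range] at hj
      tauto
    set e := J.orderEmbOfFin rfl
    have he : ∀ i, e i ∈ J := fun i => J.orderEmbOfFin_mem rfl i
    -- A bin listed in increasing order is an eluder sequence with ε' = ε, and each member is its
    -- own witness g.
    refine hd _ ⟨fun i => f (e i), fun i => hf _ (hJmem _ (he i)).1, ε, hε, fun t _ =>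
      ⟨f (e t), hf _ (hJmem _ (he t)).1, ?_, (hJmem _ (he t)).2.1⟩⟩
    refine Real.sqrt_le_iff.2 ⟨hε0.le, le_trans ?_ (hb (e t) (hJmem _ (he t)).1)⟩
    refine le_of_eq_of_le (Finset.sum_map (Finset.univ.filter (fun i => i < t)) e.toEmbedding
      (fun i => G (f (e t)) (f i) ^ 2)).symm ?_
    refine Finset.sum_le_sum_of_subset_of_nonneg ?_ (fun _ _ _ => sq_nonneg _)
    intro i hi
    obtain ⟨j, hj, rfl⟩ := Finset.mem_map.1 hi
    have hjt : j < t := (Finset.mem_filter.1 hj).2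
    simp only [Finset.mem_filter, Finset.mem_range]
    exact ⟨e.strictMono hjt, (hJmem _ (he j)).2.1,
      (hJmem _ (he j)).2.2.trans (hJmem _ (he t)).2.2.symm⟩
  have hcard : s.card ≤ K * d := by
    rw [Finset.card_eq_sum_card_fiberwise (f := b) (t := Finset.univ) (by simp)]
    calc _ ≤ ∑ _k : Fin K, d := Finset.sum_le_sum fun k _ => hbin k
      _ = K * d := by simp
  calc (s.card : ℝ) ≤ (K : ℝ) * d := by exact_mod_cast hcard
    _ ≤ (1 + B / ε ^ 2) * d := by
      refine mul_le_mul_of_nonneg_right ?_ (Nat.cast_nonneg d)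
      have := Nat.floor_le (show 0 ≤ B / ε ^ 2 by positivity)
      simp only [K]
      push_cast
      linarith
    _ = _ := mul_comm _ _

/-- The sum of the diagonal values of a coupling function along a sequence of hypotheses whose past
couplings are bounded. -/
theorem sum_abs_le_of_isEluderLength {Hyp : Type*} {F : Set Hyp} {G : Hyp → Hyp → ℝ}
    {w B R : ℝ} {d : ℕ} (hd : ∀ n, IsEluderLength F G w n → n ≤ d) (hw : 0 < w)
    (hB : 0 ≤ B) (f : ℕ → Hyp) (T : ℕ) (hf : ∀ t < T, f t ∈ F)
    (hR : ∀ t < T, |G (f t) (f t)| ≤ R)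
    (hsum : ∀ t < T, ∑ i ∈ Finset.range t, (G (f t) (f i)) ^ 2 ≤ B) :
    ∑ t ∈ Finset.range T, |G (f t) (f t)|
      ≤ T * w + (min T d : ℕ) * R + 2 * √(B * d) * √T := by
  have := sum_le_of_card_filter_le (fun t => |G (f t) (f t)|) d hw (Finset.range T)
    (fun _ _ => abs_nonneg _) (fun t ht => hR t (Finset.mem_range.1 ht))
    (fun ε hε => card_filter_le_of_isEluderLength hd hw hε hB f T hf hsum)
  rw [Finset.card_range] at this
  refine this.trans (add_le_add_right (mul_le_mul_of_nonneg_left ?_ (by positivity)) _)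
  exact Real.sqrt_le_sqrt (by exact_mod_cast Nat.sub_le T d)

/-! ### The state process: Markov property and Bellman equation -/

namespace MDP

variable {S A : Type*} [MeasurableSpace S] [MeasurableSpace A] {H : ℕ}

instance (M : MDP S A H) (π : Policy S A H) (n : ℕ) (s : S) :
    IsProbabilityMeasure (M.stateLaw π n s) := by
  unfold stateLaw
  infer_instance

instance (M : MDP S A H) (π : Policy S A H) : IsProbabilityMeasure (M.episodeLaw π) := by
  unfold episodeLaw
  exact Measure.isProbabilityMeasure_map
    (measurable_pi_lambda _ fun i => measurable_pi_apply _).aemeasurable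

instance (M : MDP S A H) (h : Fin H) : IsMarkovKernel (M.trans h) := M.markov h

theorem step_apply (M : MDP S A H) (π : Policy S A H) (h : Fin H) (s : S) :
    M.step π h s = M.trans h (s, π.act h s) := by
  rw [step, dif_pos h.2, Kernel.comap_apply]

/-- Markov property of the state process. -/
theorem stateLaw_map_pair (M : MDP S A H) (π : Policy S A H) {n k : ℕ} (hnk : n ≤ k) (s : S) :
    (M.stateLaw π n s).map (fun x => (x k, x (k + 1)))
      = ((M.stateLaw π n s).map (fun x => x k)) ⊗ₘ M.step π k := by
  have h := (Kernel.partialTraj_compProd_eq_map_traj (X := fun _ => S) (κ := M.histStep π) hnk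
    (x₀ := fun _ => s)).symm
  rw [← Kernel.traj_map_frestrictLe_apply] at h
  -- `histStep` looks only at the last coordinate of the history, so projecting by `ev` collapses
  -- the history to the current state and the history kernel to `M.step π k`.
  set ev : ((i : Finset.Iic k) → S) → S := fun y => y ⟨k, Finset.mem_Iic.2 le_rfl⟩
  have hev : Measurable ev := measurable_pi_apply _
  have h2 := congrArg (Measure.map (Prod.map ev id)) h
  rw [Measure.map_map (by fun_prop) (by fun_prop)] at h2
  refine h2.trans ?_
  refine Measure.ext_of_lintegral _ fun φ hφ => ?_
  have he : Measurable fun a : Finset.Iic k → S =>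
      ∫⁻ b, φ (Prod.map ev id (a, b)) ∂(M.histStep π k a) :=
    Measurable.lintegral_kernel_prod_right' (hφ.comp (hev.prodMap measurable_id))
  rw [lintegral_map hφ (by fun_prop), Measure.lintegral_compProd (by fun_prop),
    Measure.lintegral_compProd hφ, lintegral_map he (by fun_prop),
    lintegral_map (Measurable.lintegral_kernel_prod_right' hφ) (by fun_prop)]
  rfl

/-- The law of the state at step `k`, given the state at step `n`, as a kernel. -/
noncomputable def marginal (M : MDP S A H) (π : Policy S A H) (n k : ℕ) : Kernel S S :=
  ((Kernel.traj (X := fun _ => S) (M.histStep π) n).comap (fun s _ => s) (by fun_prop)).map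
    (fun x => x k)

instance (M : MDP S A H) (π : Policy S A H) (n k : ℕ) : IsMarkovKernel (M.marginal π n k) := by
  unfold marginal
  exact Kernel.IsMarkovKernel.map _ (by fun_prop)

theorem marginal_apply (M : MDP S A H) (π : Policy S A H) (n k : ℕ) (s : S) :
    M.marginal π n k s = (M.stateLaw π n s).map (fun x => x k) := by
  rw [marginal, Kernel.map_apply _ (by fun_prop), Kernel.comap_apply]
  rfl

theorem marginal_self (M : MDP S A H) (π : Policy S A H) (n : ℕ) :
    M.marginal π n n = Kernel.id := by
  ext1 s
  rw [marginal_apply, stateLaw]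
  have h : (fun x : ℕ → S => x n)
      = (fun y : (i : Finset.Iic n) → S => y ⟨n, Finset.mem_Iic.2 le_rfl⟩)
        ∘ Preorder.frestrictLe (π := fun _ => S) n := rfl
  rw [h, ← Measure.map_map (by fun_prop) (by fun_prop), Kernel.traj_map_frestrictLe_apply,
    Kernel.partialTraj_self, Kernel.id_apply, Measure.map_dirac' (by fun_prop), Kernel.id_apply]

theorem marginal_succ (M : MDP S A H) (π : Policy S A H) {n k : ℕ} (hnk : n ≤ k) :
    M.marginal π n (k + 1) = M.step π k ∘ₖ M.marginal π n k := by
  ext1 s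
  have h := congrArg Measure.snd (M.stateLaw_map_pair π hnk s)
  rw [Measure.snd_compProd, Measure.snd, Measure.map_map (by fun_prop) (by fun_prop)] at h
  rw [Kernel.comp_apply, marginal_apply, marginal_apply]
  exact h

/-- Chapman–Kolmogorov: `marginal_succ` splits off the last transition, while the Bellman equation
needs the first one split off. Induction on the last step reduces this to associativity of
composition. -/
theorem marginal_eq_comp_step (M : MDP S A H) (π : Policy S A H) {n k : ℕ} (hnk : n + 1 ≤ k) :
    M.marginal π n k = M.marginal π (n + 1) k ∘ₖ M.step π n := by
  induction k, hnk using Nat.le_induction with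
  | base =>
    rw [marginal_succ _ _ le_rfl, marginal_self, marginal_self, Kernel.comp_id, Kernel.id_comp]
  | succ k hk ih =>
    rw [marginal_succ _ _ (by omega : n ≤ k), ih, marginal_succ _ _ hk, Kernel.comp_assoc]

theorem measurable_policyReward (M : MDP S A H) (π : Policy S A H) (h : Fin H) :
    Measurable (fun s => M.reward h s (π.act h s)) :=
  (M.measurable_reward h).comp (measurable_id.prodMk (π.measurable_act h))

theorem integrable_policyReward (M : MDP S A H) (π : Policy S A H) (h : Fin H)
    (ν : Measure S) [IsFiniteMeasure ν] :
    Integrable (fun s => M.reward h s (π.act h s)) ν := by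
  obtain ⟨B, hB⟩ := M.reward_bdd
  refine Integrable.of_bound (M.measurable_policyReward π h).aestronglyMeasurable B
    (ae_of_all _ fun s => ?_)
  rw [Real.norm_of_nonneg (M.reward_nonneg _ _ _)]
  exact hB _ _ _

theorem value_eq_sum (M : MDP S A H) (π : Policy S A H) (n : ℕ) (s : S) :
    M.value π n s = ∑ k : Fin H,
      if n ≤ k then ∫ y, M.reward k y (π.act k y) ∂(M.marginal π n k s) else 0 := by
  have hm : ∀ k : Fin H, Integrable (fun x : ℕ → S => M.reward k (x k) (π.act k (x k)))
      (M.stateLaw π n s) := fun k => by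
    have := M.integrable_policyReward π k ((M.stateLaw π n s).map (fun x => x k))
    exact this.comp_measurable (by fun_prop)
  rw [value, integral_finsetSum]
  · refine Finset.sum_congr rfl fun k _ => ?_
    split_ifs
    · rw [marginal_apply, integral_map (measurable_pi_apply _).aemeasurable
        (M.measurable_policyReward π k).aestronglyMeasurable]
    · simp
  · intro k _
    split_ifs
    · exact hm k
    · exact integrable_zero _ _ _

/-- The Bellman equation of a policy. -/
theorem value_eq_qvalue (M : MDP S A H) (π : Policy S A H) (h : Fin H) (s : S) :
    M.value π h s = M.qvalue π h s (π.act h s) := by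
  have hint : ∀ k : Fin H, Integrable
      (fun s' => ∫ y, M.reward k y (π.act k y) ∂(M.marginal π (h + 1) k s'))
      (M.step π h s) := fun k =>
    (M.integrable_policyReward π k ((M.marginal π (h + 1) k ∘ₖ M.step π h) s)).integral_comp
  rw [qvalue, ← step_apply]
  simp_rw [value_eq_sum M π]
  rw [integral_finsetSum]
  -- The term k = h is isolated: on the left it is the immediate reward, because the marginal is a
  -- Dirac mass, and on the right it vanishes. The terms k > h agree by Chapman–Kolmogorov.
  · rw [← Finset.add_sum_erase _ _ (Finset.mem_univ h),
      ← Finset.add_sum_erase (a := h) _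
        (fun k : Fin H => ∫ a, if (h : ℕ) + 1 ≤ k then _ else (0 : ℝ) ∂(M.step π h s))
        (Finset.mem_univ h)]
    rw [if_pos le_rfl, marginal_self, Kernel.id_apply,
      integral_dirac' _ _ (M.measurable_policyReward π h).stronglyMeasurable]
    simp only [show ¬ ((h : ℕ) + 1 ≤ h) by omega, if_false, integral_zero, zero_add]
    congr 1
    refine Finset.sum_congr rfl fun k hk => ?_
    have hne : k ≠ h := (Finset.mem_erase.1 hk).1
    have hne' : (k : ℕ) ≠ h := fun e => hne (Fin.ext e)
    by_cases hlt : (h : ℕ) + 1 ≤ k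
    · rw [if_pos (by omega)]
      simp only [hlt, if_true]
      rw [marginal_eq_comp_step _ _ hlt,
        Kernel.integral_comp (M.integrable_policyReward π k _)]
    · rw [if_neg (by omega)]
      simp [hlt]
  · intro k _
    split_ifs
    · exact hint k
    · exact integrable_zero _ _ _

/-- A bound uniform over policies is what makes the real-valued supremum in `optQ` an actual upper
bound, rather than the default value of an unbounded `⨆`. -/
theorem exists_value_le (M : MDP S A H) :
    ∃ B : ℝ, 0 ≤ B ∧ ∀ (π : Policy S A H) (n : ℕ) (s : S), |M.value π n s| ≤ B := by
  obtain ⟨B, hB⟩ := M.reward_bdd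
  refine ⟨∑ _k : Fin H, |B|, by positivity, fun π n s => ?_⟩
  rw [value, ← Real.norm_eq_abs]
  refine (norm_integral_le_of_norm_le_const (C := ∑ _k : Fin H, |B|)
    (ae_of_all _ fun x => ?_)).trans (by simp)
  refine norm_sum_le_of_le _ fun k _ => ?_
  split_ifs
  · rw [Real.norm_of_nonneg (M.reward_nonneg _ _ _)]
    exact (hB _ _ _).trans (le_abs_self _)
  · simp

theorem qvalue_le_optQ (M : MDP S A H) (π : Policy S A H) (h : Fin H) (s : S) (a : A) :
    M.qvalue π h s a ≤ M.optQ h s a := by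
  obtain ⟨B, hB0, hB⟩ := M.exists_value_le
  refine le_ciSup (f := fun π : Policy S A H => M.qvalue π h s a) ?_ π
  refine ⟨M.reward h s a + B, ?_⟩
  rintro _ ⟨π, rfl⟩
  refine add_le_add le_rfl ((le_abs_self _).trans ?_)
  rw [← Real.norm_eq_abs]
  exact (norm_integral_le_of_norm_le_const (C := B)
    (ae_of_all _ fun x => hB _ _ _)).trans (by simp)

/-- Joint law of two consecutive states of an episode. -/
theorem episodeLaw_map_pair (M : MDP S A H) (π : Policy S A H) (h : Fin H) :
    (M.episodeLaw π).map (fun x => (x h.castSucc, x h.succ))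
      = (M.marginal π 0 h M.init) ⊗ₘ M.step π h := by
  rw [episodeLaw, Measure.map_map (by fun_prop) (by fun_prop), marginal_apply]
  exact M.stateLaw_map_pair π (Nat.zero_le _) M.init

theorem episodeLaw_map_state (M : MDP S A H) (π : Policy S A H) (k : Fin (H + 1)) :
    (M.episodeLaw π).map (fun x => x k) = M.marginal π 0 k M.init := by
  rw [episodeLaw, Measure.map_map (by fun_prop) (by fun_prop), marginal_apply]
  rfl

theorem value_zero_eq_sum (M : MDP S A H) (π : Policy S A H) :
    M.value π 0 M.init = ∑ h : Fin H,
      ∫ x : Fin (H + 1) → S, M.reward h (x h.castSucc) (π.act h (x h.castSucc))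
        ∂(M.episodeLaw π) := by
  rw [value_eq_sum]
  refine Finset.sum_congr rfl fun h _ => ?_
  rw [if_pos (Nat.zero_le _), show (h : ℕ) = (h.castSucc : Fin (H + 1)) from rfl,
    ← episodeLaw_map_state, integral_map (measurable_pi_apply _).aemeasurable
      (M.measurable_policyReward π h).aestronglyMeasurable]

end MDP

/-! ### Optimism and the policy loss decomposition -/

namespace HypClasses

variable {S A Hyp : Type*} [MeasurableSpace S] [MeasurableSpace A] [MeasurableSpace Hyp] {H : ℕ}

theorem measurable_V (𝒞 : HypClasses S A Hyp H) {f : Hyp} (hf : f ∈ 𝒞.F) (n : ℕ) :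
    Measurable (𝒞.V f n) := by
  unfold V
  split_ifs with hn
  · exact (𝒞.measurable_Q f hf ⟨n, hn⟩).comp
      (measurable_id.prodMk ((𝒞.greedy f).measurable_act _))
  · exact measurable_const

/-- The optimal value is at most the value of an optimal hypothesis. -/
theorem optValue_le_V [NeZero H] {𝒞 : HypClasses S A Hyp H} {M : MDP S A H} {fstar : Hyp}
    (hstar : 𝒞.IsOptimalHyp M fstar) :
    M.optValue 0 M.init ≤ 𝒞.V fstar 0 M.init := by
  have : Nonempty (Policy S A H) := ⟨𝒞.greedy fstar⟩
  refine ciSup_le fun π => ?_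
  have h0 : ((0 : Fin H) : ℕ) = 0 := rfl
  have hH : 0 < H := Nat.pos_of_ne_zero (NeZero.ne H)
  -- The Bellman equation of the fixed policy π suffices here; the optimality equation is not
  -- needed.
  have h1 : M.value π 0 M.init ≤ M.optQ 0 M.init (π.act 0 M.init) := by
    have := M.value_eq_qvalue π 0 M.init
    rw [h0] at this
    rw [this]
    exact M.qvalue_le_optQ _ _ _ _
  rw [V, dif_pos hH]
  refine h1.trans ?_
  rw [← hstar.2]
  exact 𝒞.greedy_max fstar hstar.1 _ _ _

/-- Policy loss decomposition: the gap between the estimated and the true value of the greedy policy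
of a hypothesis is the sum of its expected Bellman errors. -/
theorem V_sub_value_eq_sum {𝒞 : HypClasses S A Hyp H} {M : MDP S A H}
    (hint : 𝒞.IntegrableValues M) {f : Hyp} (hf : f ∈ 𝒞.F) :
    𝒞.V f 0 M.init - M.value (𝒞.greedy f) 0 M.init
      = ∑ h : Fin H, ∫ x : Fin (H + 1) → S,
        (𝒞.Q f h (x h.castSucc) ((𝒞.greedy f).act h (x h.castSucc))
          - M.reward h (x h.castSucc) ((𝒞.greedy f).act h (x h.castSucc))
          - 𝒞.V f (h + 1) (x h.succ)) ∂(M.episodeLaw (𝒞.greedy f)) := by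
  set π := 𝒞.greedy f
  have hQ : ∀ (h : Fin H) s, 𝒞.Q f h s (π.act h s) = 𝒞.V f h s := fun h s => by
    rw [V, dif_pos h.2]
  have hV : ∀ k : Fin (H + 1), Integrable (fun x : Fin (H + 1) → S => 𝒞.V f k (x k))
      (M.episodeLaw π) := by
    intro k
    rcases Nat.lt_or_ge k H with hk | hk
    · exact hint f hf ⟨k, hk⟩
    · have : 𝒞.V f k = fun _ => 0 := by
        funext s
        rw [V, dif_neg (by omega)]
      simp [this]
  have hr : ∀ h : Fin H, Integrable
      (fun x : Fin (H + 1) → S => M.reward h (x h.castSucc) (π.act h (x h.castSucc)))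
      (M.episodeLaw π) := fun h => by
    have := M.integrable_policyReward π h ((M.episodeLaw π).map (fun x => x h.castSucc))
    exact this.comp_measurable (measurable_pi_apply _)
  -- W k is the mean of V_{k,f} at the state of step k, extended by the irrelevant value 0 to all k
  -- so that the sum telescopes over ℕ. It ends at W H = 0 since `𝒞.V f H` is zero.
  set W : ℕ → ℝ := fun k => if hk : k < H + 1 then
    ∫ x : Fin (H + 1) → S, 𝒞.V f k (x ⟨k, hk⟩) ∂(M.episodeLaw π) else 0
  have hsum : ∀ h : Fin H, ∫ x : Fin (H + 1) → S,
      (𝒞.Q f h (x h.castSucc) (π.act h (x h.castSucc))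
        - M.reward h (x h.castSucc) (π.act h (x h.castSucc))
        - 𝒞.V f (h + 1) (x h.succ)) ∂(M.episodeLaw π)
      = (W h - W (h + 1)) - ∫ x : Fin (H + 1) → S,
        M.reward h (x h.castSucc) (π.act h (x h.castSucc)) ∂(M.episodeLaw π) := by
    intro h
    simp_rw [hQ]
    have h1 := hV h.castSucc
    have h2 := hV h.succ
    simp only [Fin.val_castSucc, Fin.val_succ] at h1 h2
    have h12 : Integrable (fun x : Fin (H + 1) → S => 𝒞.V f h (x h.castSucc)
        - M.reward h (x h.castSucc) (π.act h (x h.castSucc))) (M.episodeLaw π) := h1.sub (hr h)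
    rw [integral_sub h12 h2, integral_sub h1 (hr h)]
    have e1 : W h = ∫ x : Fin (H + 1) → S, 𝒞.V f h (x h.castSucc) ∂(M.episodeLaw π) := by
      simp only [W]
      rw [dif_pos (by omega)]
      rfl
    have e2 : W (h + 1) = ∫ x : Fin (H + 1) → S, 𝒞.V f (h + 1) (x h.succ) ∂(M.episodeLaw π) := by
      simp only [W]
      rw [dif_pos (by omega)]
      rfl
    rw [e1, e2]
    ring
  rw [Finset.sum_congr rfl fun h _ => hsum h, Finset.sum_sub_distrib, ← M.value_zero_eq_sum,
    Fin.sum_univ_eq_sum_range (fun k => W k - W (k + 1)), Finset.sum_range_sub']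
  have hW0 : W 0 = 𝒞.V f 0 M.init := by
    simp only [W]
    rw [dif_pos (by omega)]
    have := integral_map (μ := M.episodeLaw π) (φ := fun x => x 0) (f := 𝒞.V f 0)
      (measurable_pi_apply _).aemeasurable
      (𝒞.measurable_V hf 0).aestronglyMeasurable
    refine this.symm.trans ?_
    rw [M.episodeLaw_map_state]
    change ∫ y, 𝒞.V f 0 y ∂(M.marginal π 0 0 M.init) = _
    rw [M.marginal_self, Kernel.id_apply,
      integral_dirac' _ _ (𝒞.measurable_V hf 0).stronglyMeasurable]
  have hWH : W H = 0 := by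
    simp [W, V]
  rw [hW0, hWH, sub_zero]

end HypClasses

/-! ### Exponential supermartingales and the one-step moment bound -/

section Supermartingale

variable {Ω E Y : Type*} [MeasurableSpace E] [MeasurableSpace Y]

/-- Joint law of a past-measurable variable and a variable with given conditional law. -/
theorem map_prodMk_eq_compProd_of_condExp {m mΩ : MeasurableSpace Ω} (hm : m ≤ mΩ)
    (μ : Measure Ω) [IsProbabilityMeasure μ] (κ : Kernel E Y) [IsMarkovKernel κ]
    {U : Ω → E} (hU : Measurable[m] U) {Z : Ω → Y} (hZ : Measurable Z)
    (hlaw : ∀ B, MeasurableSet B → μ[(Z ⁻¹' B).indicator (fun _ => (1 : ℝ)) | m]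
      =ᵐ[μ] fun ω => (κ (U ω)).real B) :
    μ.map (fun ω => (U ω, Z ω)) = μ.map U ⊗ₘ κ := by
  have hU' : Measurable U := hU.mono hm le_rfl
  have := Measure.isProbabilityMeasure_map (μ := μ) (hU'.prodMk hZ).aemeasurable
  refine Measure.ext_prod fun {s t} hs ht => ?_
  rw [Measure.map_apply (hU'.prodMk hZ) (hs.prod ht), Measure.compProd_apply_prod hs ht,
    setLIntegral_map hs (κ.measurable_coe ht) hU']
  have h1 : ∫ ω in U ⁻¹' s, (κ (U ω)).real t ∂μ = μ.real (U ⁻¹' s ∩ Z ⁻¹' t) := by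
    rw [← setIntegral_congr_ae (hU' hs) ((hlaw t ht).mono fun ω h _ => h),
      setIntegral_condExp hm ((integrable_const _).indicator (hZ ht)) (hU hs),
      setIntegral_indicator (hZ ht)]
    simp
  have h2 : ∫ ω in U ⁻¹' s, (κ (U ω)).real t ∂μ = (∫⁻ ω in U ⁻¹' s, κ (U ω) t ∂μ).toReal :=
    integral_toReal ((κ.measurable_coe ht).comp hU').aemeasurable
      (ae_of_all _ fun ω => measure_lt_top _ _)
  rw [h1, measureReal_def] at h2
  have h3 : ∫⁻ ω in U ⁻¹' s, κ (U ω) t ∂μ ≠ ⊤ := by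
    refine ((setLIntegral_mono' (hU' hs) (fun ω _ => prob_le_one)).trans_lt ?_).ne
    simp [measure_lt_top]
  exact (ENNReal.toReal_eq_toReal_iff' (measure_ne_top _ _) h3).1 h2

/-- Products of factors with conditional mean at most `1` have mean at most `1`. -/
theorem lintegral_prod_le_one {mΩ : MeasurableSpace Ω} (μ : Measure Ω) [IsProbabilityMeasure μ]
    (ℱ : Filtration ℕ mΩ) (κ : Kernel E Y) [IsMarkovKernel κ] {T : ℕ}
    {U : ℕ → Ω → E} (hU : ∀ t < T, Measurable[ℱ t] (U t))
    {Z : ℕ → Ω → Y} (hZ : ∀ t < T, Measurable[ℱ (t + 1)] (Z t))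
    (hlaw : ∀ t < T, ∀ B, MeasurableSet B → μ[(Z t ⁻¹' B).indicator (fun _ => (1 : ℝ)) | ℱ t]
      =ᵐ[μ] fun ω => (κ (U t ω)).real B)
    {φ : E × Y → ENNReal} (hφ : Measurable φ) (hφ1 : ∀ e, ∫⁻ y, φ (e, y) ∂(κ e) ≤ 1)
    {t : ℕ} (ht : t ≤ T) :
    Measurable[ℱ t] (fun ω => ∏ i ∈ Finset.range t, φ (U i ω, Z i ω)) ∧
      ∫⁻ ω, ∏ i ∈ Finset.range t, φ (U i ω, Z i ω) ∂μ ≤ 1 := by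
  induction t with
  | zero => exact ⟨by simp, by simp⟩
  | succ t ih =>
    obtain ⟨hmeas, hle⟩ := ih (by omega)
    have htT : t < T := by omega
    set W : Ω → ENNReal := fun ω => ∏ i ∈ Finset.range t, φ (U i ω, Z i ω)
    simp_rw [Finset.prod_range_succ]
    have hUt : Measurable (U t) := (hU t htT).mono (ℱ.le t) le_rfl
    have hZt : Measurable (Z t) := (hZ t htT).mono (ℱ.le _) le_rfl
    have hWt : Measurable W := hmeas.mono (ℱ.le t) le_rfl
    constructor
    · refine Measurable.mul (hmeas.mono (ℱ.mono t.le_succ) le_rfl) ?_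
      exact hφ.comp (((hU t htT).mono (ℱ.mono t.le_succ) le_rfl).prodMk (hZ t htT))
    -- The running product W is carried along with U as one past-measurable variable. The joint law
    -- with Z is then a composition-product with a kernel that ignores W, and integrating Z out
    -- first leaves a factor at most 1.
    · have hjoint := map_prodMk_eq_compProd_of_condExp (ℱ.le t) μ
        (κ.comap (Prod.snd : ENNReal × E → E) measurable_snd)
        (U := fun ω => (W ω, U t ω)) (hmeas.prodMk (hU t htT)) hZt
        (fun B hB => by simpa only [Kernel.comap_apply] using hlaw t htT B hB)
      have hψ : Measurable (fun p : (ENNReal × E) × Y => p.1.1 * φ (p.1.2, p.2)) := by fun_prop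
      have h1 := lintegral_map (μ := μ) hψ ((hWt.prodMk hUt).prodMk hZt)
      rw [hjoint, Measure.lintegral_compProd hψ] at h1
      calc ∫⁻ ω, W ω * φ (U t ω, Z t ω) ∂μ
          = _ := h1.symm
        _ ≤ ∫⁻ a, a.1 ∂(μ.map (fun ω => (W ω, U t ω))) := by
          refine lintegral_mono fun a => ?_
          have hφa : Measurable fun y => φ (a.2, y) := hφ.comp measurable_prodMk_left
          refine (lintegral_const_mul a.1 hφa).trans_le ?_
          exact mul_le_of_le_one_right' (hφ1 a.2)
        _ = ∫⁻ ω, W ω ∂μ := lintegral_map measurable_fst (hWt.prodMk hUt)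
        _ ≤ 1 := hle

/-- Chernoff bound for sums whose increments have conditional exponential moments at most `1`. -/
theorem measure_le_sum_le_exp {mΩ : MeasurableSpace Ω} (μ : Measure Ω) [IsProbabilityMeasure μ]
    (ℱ : Filtration ℕ mΩ) (κ : Kernel E Y) [IsMarkovKernel κ] {T : ℕ}
    {U : ℕ → Ω → E} (hU : ∀ t < T, Measurable[ℱ t] (U t))
    {Z : ℕ → Ω → Y} (hZ : ∀ t < T, Measurable[ℱ (t + 1)] (Z t))
    (hlaw : ∀ t < T, ∀ B, MeasurableSet B → μ[(Z t ⁻¹' B).indicator (fun _ => (1 : ℝ)) | ℱ t]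
      =ᵐ[μ] fun ω => (κ (U t ω)).real B)
    {φ : E × Y → ℝ} (hφ : Measurable φ)
    (hφ1 : ∀ e, ∫⁻ y, ENNReal.ofReal (Real.exp (φ (e, y))) ∂(κ e) ≤ 1)
    {t : ℕ} (ht : t ≤ T) (a : ℝ) :
    μ {ω | a ≤ ∑ i ∈ Finset.range t, φ (U i ω, Z i ω)} ≤ ENNReal.ofReal (Real.exp (-a)) := by
  obtain ⟨hmeas, hle⟩ := lintegral_prod_le_one μ ℱ κ hU hZ hlaw
    (φ := fun p => ENNReal.ofReal (Real.exp (φ p))) (by fun_prop) hφ1 ht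
  have hpos : 0 < Real.exp a := Real.exp_pos a
  have h1 := meas_ge_le_lintegral_div (μ := μ) (hmeas.mono (ℱ.le t) le_rfl).aemeasurable
    (ε := ENNReal.ofReal (Real.exp a)) (by simpa using hpos) ENNReal.ofReal_ne_top
  rw [Real.exp_neg, ENNReal.ofReal_inv_of_pos hpos]
  refine (measure_mono fun ω hω => ?_).trans (h1.trans ?_)
  · simp only [Set.mem_ofPred_eq] at hω ⊢
    rw [← ENNReal.ofReal_prod_of_nonneg (fun _ _ => (Real.exp_pos _).le), ← Real.exp_sum]
    exact ENNReal.ofReal_le_ofReal (Real.exp_le_exp.2 hω)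
  · rw [ENNReal.div_eq_inv_mul]
    exact mul_le_of_le_one_right' hle

end Supermartingale

/-- Exponential moment of the difference of the squared norms of a bounded random vector and of its
centred version. -/
theorem lintegral_exp_sq_norm_sub_le {α : Type*} [MeasurableSpace α] {d : ℕ} (ν : Measure α)
    [IsProbabilityMeasure ν] {X X₀ : α → EuclideanSpace ℝ (Fin d)} (hX : Measurable X)
    (hX₀ : Measurable X₀) {R : ℝ} (hR : 0 < R) (hXR : ∀ s, ‖X s‖ ≤ R) (hX₀R : ∀ s, ‖X₀ s‖ ≤ R)
    (hcenter : ∀ᵐ s ∂ν, X s - ∫ s', X s' ∂ν = X₀ s) :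
    ∫⁻ s, ENNReal.ofReal (Real.exp (-(1 / (4 * R ^ 2)) * (‖X s‖ ^ 2 - ‖X₀ s‖ ^ 2))) ∂ν
      ≤ ENNReal.ofReal (Real.exp (-(1 / (8 * R ^ 2)) * ‖∫ s', X s' ∂ν‖ ^ 2)) := by
  set e := ∫ s', X s' ∂ν
  have hXint : Integrable X ν := Integrable.of_bound hX.aestronglyMeasurable R (ae_of_all _ hXR)
  have hX₀int : Integrable X₀ ν :=
    Integrable.of_bound hX₀.aestronglyMeasurable R (ae_of_all _ hX₀R)
  have hX₀0 : ∫ s, X₀ s ∂ν = 0 := by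
    rw [← integral_congr_ae hcenter, integral_sub hXint (integrable_const _)]
    simp [e]
  -- Since X = e + X₀, the difference of squares is ‖e‖² + 2y, where y is centred and bounded by
  -- ‖e‖R. Hoeffding at λ = 1/(4R²) gives the exponent (-λ + 2λ²R²)‖e‖², and this λ is the
  -- minimizer.
  set y : α → ℝ := fun s => inner ℝ e (X₀ s)
  have hy : Measurable y := measurable_const.inner hX₀
  have hy0 : ν[y] = 0 := by
    have := integral_inner (𝕜 := ℝ) hX₀int e
    rw [hX₀0, inner_zero_right] at this
    exact this
  have hyb : ∀ s, y s ∈ Set.Icc (-(‖e‖ * R)) (‖e‖ * R) := fun s => by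
    refine abs_le.1 ((abs_real_inner_le_norm _ _).trans ?_)
    exact mul_le_mul_of_nonneg_left (hX₀R s) (norm_nonneg _)
  have hsub := hasSubgaussianMGF_of_mem_Icc_of_integral_eq_zero hy.aemeasurable
    (ae_of_all ν hyb) hy0
  have hmgf := hsub.mgf_le (-(1 / (2 * R ^ 2)))
  have hc : ((((‖‖e‖ * R - -(‖e‖ * R)‖₊ / 2) ^ 2 : NNReal)) : ℝ) = ‖e‖ ^ 2 * R ^ 2 := by
    push_cast
    rw [Real.norm_of_nonneg (by have := mul_nonneg (norm_nonneg e) hR.le; linarith)]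
    ring
  rw [hc] at hmgf
  have hexp : ‖e‖ ^ 2 * R ^ 2 * (-(1 / (2 * R ^ 2))) ^ 2 / 2 = 1 / (8 * R ^ 2) * ‖e‖ ^ 2 := by
    field_simp
    norm_num
  rw [hexp] at hmgf
  have hpt : ∀ᵐ s ∂ν, Real.exp (-(1 / (4 * R ^ 2)) * (‖X s‖ ^ 2 - ‖X₀ s‖ ^ 2))
      = Real.exp (-(1 / (4 * R ^ 2)) * ‖e‖ ^ 2) * Real.exp (-(1 / (2 * R ^ 2)) * y s) := by
    filter_upwards [hcenter] with s hs
    have h1 : X s = e + X₀ s := by rw [← hs]; abel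
    rw [← Real.exp_add, h1, norm_add_sq_real]
    congr 1
    simp only [y]
    field_simp
    ring
  rw [lintegral_congr_ae (hpt.mono fun s hs => by rw [hs]), ← ofReal_integral_eq_lintegral_ofReal
    ((hsub.integrable_exp_mul _).const_mul _) (ae_of_all _ fun s => by positivity)]
  refine ENNReal.ofReal_le_ofReal ?_
  rw [integral_const_mul]
  refine (mul_le_mul_of_nonneg_left hmgf (Real.exp_pos _).le).trans (le_of_eq ?_)
  rw [← Real.exp_add]
  congr 1
  field_simp
  ring

/-! ### Episode laws as kernels from the hypothesis class -/

namespace HypClasses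

variable {S A Hyp : Type*} [MeasurableSpace S] [MeasurableSpace A] [MeasurableSpace Hyp] {H d : ℕ}

/-- The steps of the state process under the greedy policies, jointly in the hypothesis. -/
noncomputable def greedyStep (𝒞 : HypClasses S A Hyp H) (M : MDP S A H) (n : ℕ) :
    Kernel (𝒞.F × S) S :=
  if hn : n < H then
    (M.trans ⟨n, hn⟩).comap (fun p => (p.2, (𝒞.greedy p.1).act ⟨n, hn⟩ p.2))
      (measurable_snd.prodMk (𝒞.measurable_greedy ⟨n, hn⟩))
  else Kernel.id.comap Prod.snd measurable_snd

instance (𝒞 : HypClasses S A Hyp H) (M : MDP S A H) (n : ℕ) :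
    IsMarkovKernel (𝒞.greedyStep M n) := by
  unfold greedyStep
  split_ifs <;> infer_instance

theorem greedyStep_apply (𝒞 : HypClasses S A Hyp H) (M : MDP S A H) (n : ℕ) (f : 𝒞.F) (s : S) :
    𝒞.greedyStep M n (f, s) = M.step (𝒞.greedy f) n s := by
  unfold greedyStep MDP.step
  split_ifs
  · rw [Kernel.comap_apply, Kernel.comap_apply]
  · rw [Kernel.comap_apply]

/-- The law of the state at a given step under the greedy policy of a hypothesis. -/
noncomputable def greedyState (𝒞 : HypClasses S A Hyp H) (M : MDP S A H) : ℕ → Kernel 𝒞.F S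
  | 0 => Kernel.const _ (Measure.dirac M.init)
  | n + 1 => (greedyState 𝒞 M n ⊗ₖ 𝒞.greedyStep M n).snd

instance (𝒞 : HypClasses S A Hyp H) (M : MDP S A H) (n : ℕ) :
    IsMarkovKernel (𝒞.greedyState M n) := by
  induction n with
  | zero => unfold greedyState; infer_instance
  | succ n ih => unfold greedyState; infer_instance

theorem greedyState_compProd_apply (𝒞 : HypClasses S A Hyp H) (M : MDP S A H) (n : ℕ) (f : 𝒞.F) :
    (𝒞.greedyState M n ⊗ₖ 𝒞.greedyStep M n) f
      = 𝒞.greedyState M n f ⊗ₘ M.step (𝒞.greedy f) n := by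
  rw [Kernel.compProd_apply_eq_compProd_sectR]
  congr 1
  ext1 s
  rw [Kernel.sectR_apply, greedyStep_apply]

/-- `greedyState` is built recursively so as to be measurable in the hypothesis, which the marginals
of separate policies do not give. Both sides satisfy the same forward recursion. -/
theorem greedyState_apply (𝒞 : HypClasses S A Hyp H) (M : MDP S A H) (n : ℕ) (f : 𝒞.F) :
    𝒞.greedyState M n f = M.marginal (𝒞.greedy f) 0 n M.init := by
  induction n with
  | zero => rw [MDP.marginal_self, Kernel.id_apply, greedyState, Kernel.const_apply]
  | succ n ih =>
    rw [greedyState, Kernel.snd_apply, greedyState_compProd_apply, ih, ← Measure.snd,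
      Measure.snd_compProd, MDP.marginal_succ _ _ (Nat.zero_le n), Kernel.comp_apply]

/-- Joint law of two consecutive states, as a kernel from the hypotheses. -/
theorem episodeLaw_map_eq (𝒞 : HypClasses S A Hyp H) (M : MDP S A H) (h : Fin H) (f : 𝒞.F) :
    (M.episodeLaw (𝒞.greedy f)).map (fun x => (x h.castSucc, x h.succ))
      = (𝒞.greedyState M h ⊗ₖ 𝒞.greedyStep M h) f := by
  rw [MDP.episodeLaw_map_pair, greedyState_compProd_apply, greedyState_apply]

end HypClasses

/-! ### Concentration for a fixed tuple (h, f, g, v) -/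

section Concentration

variable {S A Hyp : Type*} [MeasurableSpace S] [MeasurableSpace A] [MeasurableSpace Hyp]
  {H d : ℕ}

/-- `E_{π_{f'}} ‖E_{s_{h+1}} ℓ_{h,f'}(o_h, f, g, v)‖²`. -/
noncomputable def avgSqCondMean (M : MDP S A H) (𝒞 : HypClasses S A Hyp H)
    (ℓ : EstFun S A Hyp H d) (h : Fin H) (f' f g : Hyp) (v : S × A × S → ℝ) : ℝ :=
  ∫ x : Fin (H + 1) → S,
    ‖condMean M ℓ h f' f g v (x h.castSucc) ((𝒞.greedy f').act h (x h.castSucc))‖ ^ 2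
      ∂(M.episodeLaw (𝒞.greedy f'))

variable {M : MDP S A H} {𝒞 : HypClasses S A Hyp H} {𝒱 : Set (S × A × S → ℝ)} {fstar : Hyp}
  {ℓ : EstFun S A Hyp H d} {R : ℝ}

namespace IsDEF

variable (hdef : IsDEF M 𝒞 𝒱 fstar ℓ R) {h : Fin H} {f g : Hyp} (hf : f ∈ 𝒞.F) (hg : g ∈ 𝒞.G)
  {v : S × A × S → ℝ} (hv : v ∈ 𝒱)

include hdef hf hg hv

theorem norm_condMean_le {f' : Hyp} (hf' : f' ∈ 𝒞.F) (s : S) (a : A) :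
    ‖condMean M ℓ h f' f g v s a‖ ≤ R :=
  (norm_integral_le_of_norm_le_const
    (ae_of_all _ fun _ => hdef.bounded h f' hf' f hf g hg v hv _)).trans (by simp)

theorem measurable_condMean_greedy :
    Measurable (fun p : 𝒞.F × S =>
      condMean M ℓ h p.1 f g v p.2 ((𝒞.greedy p.1).act h p.2)) := by
  have h1 : Measurable (fun q : (𝒞.F × S) × S =>
      ℓ h q.1.1 (q.1.2, (𝒞.greedy q.1.1).act h q.1.2, q.2) f g v) :=
    (hdef.measurable h f hf g hg v hv).comp
      (measurable_fst.fst.prodMk (measurable_fst.snd.prodMk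
        (((𝒞.measurable_greedy h).comp measurable_fst).prodMk measurable_snd)))
  have h2 := (h1.stronglyMeasurable.integral_kernel_prod_right' (κ := 𝒞.greedyStep M h)).measurable
  refine (congrArg Measurable (funext fun p => ?_)).mpr h2
  rw [HypClasses.greedyStep_apply, MDP.step_apply]
  rfl

/-- The integrand sees the episode only through the state at step h. Written as an integral against
a kernel, the mean square becomes measurable in f'. -/
theorem avgSqCondMean_eq (f' : 𝒞.F) :
    avgSqCondMean M 𝒞 ℓ h f' f g v
      = ∫ s, ‖condMean M ℓ h f' f g v s ((𝒞.greedy f').act h s)‖ ^ 2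
        ∂(𝒞.greedyState M h f') := by
  have hm : Measurable fun s => ‖condMean M ℓ h f' f g v s ((𝒞.greedy f').act h s)‖ ^ 2 :=
    (((hdef.measurable_condMean_greedy hf hg hv).comp measurable_prodMk_left).norm).pow_const 2
  rw [HypClasses.greedyState_apply, show (h : ℕ) = (h.castSucc : Fin (H + 1)) from rfl,
    ← MDP.episodeLaw_map_state, integral_map (measurable_pi_apply _).aemeasurable
      hm.aestronglyMeasurable]
  rfl

theorem measurable_avgSqCondMean :
    Measurable (fun f' : 𝒞.F => avgSqCondMean M 𝒞 ℓ h f' f g v) := by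
  simp_rw [hdef.avgSqCondMean_eq hf hg hv]
  have hm := (((hdef.measurable_condMean_greedy (h := h) hf hg hv).norm).pow_const 2)
  exact (hm.stronglyMeasurable.integral_kernel_prod_right' (κ := 𝒞.greedyState M h)).measurable

theorem avgSqCondMean_le {f' : Hyp} (hf' : f' ∈ 𝒞.F) :
    avgSqCondMean M 𝒞 ℓ h f' f g v ≤ R ^ 2 := by
  refine (le_abs_self _).trans ?_
  rw [← Real.norm_eq_abs]
  refine (norm_integral_le_of_norm_le_const (C := R ^ 2) (ae_of_all _ fun x => ?_)).trans (by simp)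
  rw [norm_pow, norm_norm]
  exact pow_le_pow_left₀ (norm_nonneg _) (hdef.norm_condMean_le hf hg hv hf' _ _) 2

/-- The exponential moment of the excess loss is controlled by the mean squared error. -/
theorem lintegral_exp_excess_le_one (hR : 0 < R) {g₀ : Hyp} (hg₀ : g₀ ∈ 𝒞.G)
    (hdec : ∀ f' ∈ 𝒞.F, ∀ s a, ∀ᵐ s' ∂(M.trans h (s, a)),
      ℓ h f' (s, a, s') f g v - condMean M ℓ h f' f g v s a = ℓ h f' (s, a, s') f g₀ v)
    (f' : 𝒞.F) :
    ∫⁻ y : S × S, ENNReal.ofReal (Real.exp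
      (-(1 / (4 * R ^ 2)) * (‖ℓ h f' (y.1, (𝒞.greedy f').act h y.1, y.2) f g v‖ ^ 2
          - ‖ℓ h f' (y.1, (𝒞.greedy f').act h y.1, y.2) f g₀ v‖ ^ 2)
        + 1 / (16 * R ^ 2) * avgSqCondMean M 𝒞 ℓ h f' f g v))
      ∂((𝒞.greedyState M h ⊗ₖ 𝒞.greedyStep M h) f') ≤ 1 := by
  have hmo : Measurable (fun y : S × S => ((f', (y.1, (𝒞.greedy f').act h y.1, y.2)) :
      𝒞.F × (S × A × S))) :=
    measurable_const.prodMk (measurable_fst.prodMk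
      ((((𝒞.greedy f').measurable_act h).comp measurable_fst).prodMk measurable_snd))
  have hm1 := (hdef.measurable h f hf g hg v hv).comp hmo
  have hm2 := (hdef.measurable h f hf g₀ hg₀ v hv).comp hmo
  simp only [Function.comp_def] at hm1 hm2
  simp_rw [Real.exp_add, ENNReal.ofReal_mul (Real.exp_pos _).le]
  have hmeas : Measurable fun y : S × S => ENNReal.ofReal (Real.exp
      (-(1 / (4 * R ^ 2)) * (‖ℓ h f' (y.1, (𝒞.greedy f').act h y.1, y.2) f g v‖ ^ 2
          - ‖ℓ h f' (y.1, (𝒞.greedy f').act h y.1, y.2) f g₀ v‖ ^ 2))) :=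
    (((hm1.norm.pow_const 2).sub (hm2.norm.pow_const 2)).const_mul _).exp.ennreal_ofReal
  rw [lintegral_mul_const _ hmeas, HypClasses.greedyState_compProd_apply,
    Measure.lintegral_compProd hmeas]
  set e : S → EuclideanSpace ℝ (Fin d) :=
    fun s => condMean M ℓ h f' f g v s ((𝒞.greedy f').act h s) with he
  have hemeas : Measurable e :=
    (hdef.measurable_condMean_greedy hf hg hv).comp measurable_prodMk_left
  have heR : ∀ s, ‖e s‖ ≤ R := fun s => hdef.norm_condMean_le hf hg hv f'.2 _ _
  have hesq : ∀ s, 1 / (16 * R ^ 2) * ‖e s‖ ^ 2 ≤ 1 / 16 := fun s => by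
    have := pow_le_pow_left₀ (norm_nonneg (e s)) (heR s) 2
    rw [one_div_mul_eq_div, div_le_div_iff₀ (by positivity) (by norm_num)]
    linarith
  -- With u = ‖e s‖²/(16R²) ≤ 1/16, the one-step bound exp(-2u) is weakened to 1 - u. Being linear
  -- in u, this can be averaged over the state and then raised to exp(-E u); Jensen for exp itself
  -- goes the wrong way.
  have hinner : ∀ s, ∫⁻ s', ENNReal.ofReal (Real.exp
      (-(1 / (4 * R ^ 2)) * (‖ℓ h f' (s, (𝒞.greedy f').act h s, s') f g v‖ ^ 2
          - ‖ℓ h f' (s, (𝒞.greedy f').act h s, s') f g₀ v‖ ^ 2))) ∂(M.step (𝒞.greedy f') h s)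
      ≤ ENNReal.ofReal (1 - 1 / (16 * R ^ 2) * ‖e s‖ ^ 2) := by
    intro s
    rw [MDP.step_apply]
    refine (lintegral_exp_sq_norm_sub_le (M.trans h (s, (𝒞.greedy f').act h s))
      (hm1.comp measurable_prodMk_left) (hm2.comp measurable_prodMk_left) hR
      (fun _ => hdef.bounded h f' f'.2 f hf g hg v hv _)
      (fun _ => hdef.bounded h f' f'.2 f hf g₀ hg₀ v hv _) (hdec f' f'.2 _ _)).trans ?_
    refine ENNReal.ofReal_le_ofReal ?_
    change Real.exp (-(1 / (8 * R ^ 2)) * ‖e s‖ ^ 2) ≤ _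
    set u := 1 / (16 * R ^ 2) * ‖e s‖ ^ 2 with hu
    have hu0 : 0 ≤ u := by positivity
    have hu1 : u ≤ 1 / 16 := hesq s
    have h2 : -(1 / (8 * R ^ 2)) * ‖e s‖ ^ 2 = -(2 * u) := by
      rw [hu]
      field_simp
      ring
    rw [h2, Real.exp_neg, inv_le_comm₀ (Real.exp_pos _) (by linarith)]
    refine le_trans ?_ (Real.add_one_le_exp _)
    rw [inv_le_iff_one_le_mul₀ (by linarith)]
    nlinarith
  have hint : Integrable (fun s => 1 / (16 * R ^ 2) * ‖e s‖ ^ 2) (𝒞.greedyState M h f') := by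
    refine Integrable.of_bound ((hemeas.norm.pow_const 2).const_mul _).aestronglyMeasurable (1 / 16)
      (ae_of_all _ fun s => ?_)
    rw [Real.norm_of_nonneg (by positivity)]
    exact hesq s
  have hint' : Integrable (fun s => 1 - 1 / (16 * R ^ 2) * ‖e s‖ ^ 2) (𝒞.greedyState M h f') :=
    (integrable_const _).sub hint
  have houter : ∫⁻ s, ENNReal.ofReal (1 - 1 / (16 * R ^ 2) * ‖e s‖ ^ 2) ∂(𝒞.greedyState M h f')
      ≤ ENNReal.ofReal (Real.exp (-(1 / (16 * R ^ 2) * avgSqCondMean M 𝒞 ℓ h f' f g v))) := by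
    rw [← ofReal_integral_eq_lintegral_ofReal hint' (ae_of_all _ fun s => by
        have := hesq s
        change 0 ≤ 1 - 1 / (16 * R ^ 2) * ‖e s‖ ^ 2
        linarith)]
    refine ENNReal.ofReal_le_ofReal ?_
    rw [integral_sub (integrable_const _) hint, integral_const_mul,
      hdef.avgSqCondMean_eq hf hg hv]
    simp only [integral_const, probReal_univ, smul_eq_mul, one_mul]
    exact Real.one_sub_le_exp_neg _
  refine (mul_le_mul_left ((lintegral_mono hinner).trans houter) _).trans ?_
  rw [← ENNReal.ofReal_mul (Real.exp_pos _).le, ← Real.exp_add]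
  simp

end IsDEF

/-- Concentration of the excess loss along a run of OPERA. -/
theorem IsOperaRun.measure_excess_le [NeZero H] (hdef : IsDEF M 𝒞 𝒱 fstar ℓ R) (hR : 0 < R)
    {Ω : Type*} {mΩ : MeasurableSpace Ω} {μ : Measure Ω} [IsProbabilityMeasure μ]
    {ℱ : Filtration ℕ mΩ} {fs : ℕ → Ω → Hyp} {x : ℕ → Ω → Fin (H + 1) → S} {β : ℝ} {T : ℕ}
    (hrun : IsOperaRun M 𝒞 𝒱 ℓ β T μ ℱ fs x)
    {h : Fin H} {f g g₀ : Hyp} {v : S × A × S → ℝ} (hf : f ∈ 𝒞.F) (hg : g ∈ 𝒞.G)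
    (hg₀ : g₀ ∈ 𝒞.G) (hv : v ∈ 𝒱)
    (hdec : ∀ f' ∈ 𝒞.F, ∀ s a, ∀ᵐ s' ∂(M.trans h (s, a)),
      ℓ h f' (s, a, s') f g v - condMean M ℓ h f' f g v s a = ℓ h f' (s, a, s') f g₀ v)
    {t : ℕ} (ht : t ≤ T) (a : ℝ) :
    μ {ω | a ≤ ∑ i ∈ Finset.range t,
      (-(1 / (4 * R ^ 2)) * (‖ℓ h (fs i ω) (obs (𝒞.greedy (fs i ω)) (x i ω) h) f g v‖ ^ 2
          - ‖ℓ h (fs i ω) (obs (𝒞.greedy (fs i ω)) (x i ω) h) f g₀ v‖ ^ 2)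
        + 1 / (16 * R ^ 2) * avgSqCondMean M 𝒞 ℓ h (fs i ω) f g v)}
      ≤ ENNReal.ofReal (Real.exp (-a)) := by
  -- Membership in 𝓕 is known only for episodes i < T; the value f afterwards is a dummy.
  set U : ℕ → Ω → 𝒞.F := fun i ω =>
    if hi : i < T then ⟨fs i ω, hrun.mem i hi ω⟩ else ⟨f, hf⟩ with hUdef
  have hUeq : ∀ i < T, ∀ ω, (U i ω : Hyp) = fs i ω := fun i hi ω => by simp [hUdef, hi]
  have hU : ∀ i < T, Measurable[ℱ i] (U i) := fun i hi => by
    have : U i = fun ω => ⟨fs i ω, hrun.mem i hi ω⟩ := by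
      funext ω
      simp [hUdef, hi]
    rw [this]
    exact (hrun.measurable_hyp i hi).subtype_mk
  have hpair : Measurable fun y : Fin (H + 1) → S => (y h.castSucc, y h.succ) := by fun_prop
  have hmo : Measurable (fun p : 𝒞.F × (S × S) =>
      ((p.1, (p.2.1, (𝒞.greedy p.1).act h p.2.1, p.2.2)) : 𝒞.F × (S × A × S))) :=
    measurable_fst.prodMk (measurable_snd.fst.prodMk
      (((𝒞.measurable_greedy h).comp (measurable_fst.prodMk measurable_snd.fst)).prodMk
        measurable_snd.snd))
  have hm1 := (hdef.measurable h f hf g hg v hv).comp hmo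
  have hm2 := (hdef.measurable h f hf g₀ hg₀ v hv).comp hmo
  have hm3 := hdef.measurable_avgSqCondMean (h := h) hf hg hv
  simp only [Function.comp_def] at hm1 hm2
  have key := measure_le_sum_le_exp μ ℱ (𝒞.greedyState M h ⊗ₖ 𝒞.greedyStep M h) hU
    (Z := fun i ω => (x i ω h.castSucc, x i ω h.succ))
    (fun i hi => hpair.comp (hrun.measurable_states i hi))
    (fun i hi B hB => by
      have := hrun.law i hi _ (hpair hB)
      refine this.trans (ae_of_all _ fun ω => ?_)
      dsimp only
      rw [← HypClasses.episodeLaw_map_eq, hUeq i hi, map_measureReal_apply hpair hB])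
    (φ := fun p => -(1 / (4 * R ^ 2)) *
      (‖ℓ h p.1 (p.2.1, (𝒞.greedy p.1).act h p.2.1, p.2.2) f g v‖ ^ 2
          - ‖ℓ h p.1 (p.2.1, (𝒞.greedy p.1).act h p.2.1, p.2.2) f g₀ v‖ ^ 2)
        + 1 / (16 * R ^ 2) * avgSqCondMean M 𝒞 ℓ h p.1 f g v)
    ((((hm1.norm.pow_const 2).sub (hm2.norm.pow_const 2)).const_mul _).add
      ((hm3.comp measurable_fst).const_mul _))
    (hdef.lintegral_exp_excess_le_one hf hg hv hR hg₀ hdec) ht a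
  refine le_trans (le_of_eq ?_) key
  congr 1
  ext ω
  simp only [Set.mem_ofPred_eq]
  rw [Finset.sum_congr rfl fun i hi => ?_]
  rw [hUeq i (by have := Finset.mem_range.1 hi; omega)]
  rfl

end Concentration

/-! ### Covers and representatives -/

section Covering

variable {S A Hyp : Type*} [MeasurableSpace S] [MeasurableSpace A] [MeasurableSpace Hyp]
  {H d : ℕ} {𝒞 : HypClasses S A Hyp H} {𝒱 : Set (S × A × S → ℝ)} {ℓ : EstFun S A Hyp H d}

/-- A finite covering number is attained. -/
theorem exists_finset_cover {ε : ℝ} (hcov : coveringNumberEst 𝒞 𝒱 ℓ ε ≠ ⊤) :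
    ∃ N : Finset (Hyp → S × A × S → EuclideanSpace ℝ (Fin d)),
      N.card = (coveringNumberEst 𝒞 𝒱 ℓ ε).toNat ∧
      ∀ h, ∀ f ∈ 𝒞.F, ∀ g ∈ 𝒞.G, ∀ v ∈ 𝒱, ∃ φ ∈ N, ∀ f' ∈ 𝒞.F, ∀ o,
        ‖ℓ h f' o f g v - φ f' o‖ ≤ ε := by
  set P : Set (Hyp → S × A × S → EuclideanSpace ℝ (Fin d)) → Prop := fun N =>
    ∀ h, ∀ f ∈ 𝒞.F, ∀ g ∈ 𝒞.G, ∀ v ∈ 𝒱, ∃ φ ∈ N, ∀ f' ∈ 𝒞.F, ∀ o,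
      ‖ℓ h f' o f g v - φ f' o‖ ≤ ε with hP
  have heq : coveringNumberEst 𝒞 𝒱 ℓ ε = ⨅ N : {N // P N}, N.1.encard := by
    rw [coveringNumberEst, iInf_subtype']
  have hne : Nonempty {N // P N} := by
    by_contra hcon
    rw [not_nonempty_iff] at hcon
    exact hcov (by rw [heq, iInf_of_empty])
  obtain ⟨⟨N, hN⟩, hNeq⟩ := ciInf_mem fun N : {N // P N} => N.1.encard
  rw [← heq] at hNeq
  have hfin : N.Finite := Set.encard_ne_top_iff.1 (by rw [← hNeq] at hcov; exact hcov)
  refine ⟨hfin.toFinset, ?_, fun h f hf g hg v hv => ?_⟩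
  · rw [← hNeq]
    dsimp only
    rw [hfin.encard_eq_coe_toFinset_card, ENat.toNat_natCast]
  · obtain ⟨φ, hφ, h2⟩ := hN h f hf g hg v hv
    exact ⟨φ, hfin.mem_toFinset.2 hφ, h2⟩

/-- Finitely many indices whose estimation functions, together with those of a modified second
hypothesis, approximate all estimation functions. -/
theorem exists_representatives {ε : ℝ} {N : Finset (Hyp → S × A × S → EuclideanSpace ℝ (Fin d))}
    (hN : ∀ h, ∀ f ∈ 𝒞.F, ∀ g ∈ 𝒞.G, ∀ v ∈ 𝒱, ∃ φ ∈ N, ∀ f' ∈ 𝒞.F, ∀ o,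
        ‖ℓ h f' o f g v - φ f' o‖ ≤ ε)
    {𝒯 : Hyp → Hyp} (h𝒯 : ∀ f ∈ 𝒞.F, 𝒯 f ∈ 𝒞.G) :
    ∃ s : Finset (Fin H × Hyp × Hyp × (S × A × S → ℝ)), s.card ≤ H * N.card ^ 2 ∧
      (∀ i ∈ s, i.2.1 ∈ 𝒞.F ∧ i.2.2.1 ∈ 𝒞.G ∧ i.2.2.2 ∈ 𝒱) ∧
      ∀ h, ∀ f ∈ 𝒞.F, ∀ g ∈ 𝒞.G, ∀ v ∈ 𝒱, ∃ i ∈ s, i.1 = h ∧ ∀ f' ∈ 𝒞.F, ∀ o,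
        ‖ℓ h f' o f g v - ℓ h f' o i.2.1 i.2.2.1 i.2.2.2‖ ≤ 2 * ε ∧
        ‖ℓ h f' o f (𝒯 f) v - ℓ h f' o i.2.1 (𝒯 i.2.1) i.2.2.2‖ ≤ 2 * ε := by
  classical
  let I := {i : Fin H × Hyp × Hyp × (S × A × S → ℝ) // i.2.1 ∈ 𝒞.F ∧ i.2.2.1 ∈ 𝒞.G ∧ i.2.2.2 ∈ 𝒱}
  rcases isEmpty_or_nonempty I with hI | hI
  · exact ⟨∅, by simp, by simp, fun h f hf g hg v hv => (hI.false ⟨(h, f, g, v), hf, hg, hv⟩).elim⟩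
  have hφ : ∀ i : I, ∃ φ ∈ N, ∀ f' ∈ 𝒞.F, ∀ o,
      ‖ℓ i.1.1 f' o i.1.2.1 i.1.2.2.1 i.1.2.2.2 - φ f' o‖ ≤ ε :=
    fun i => hN _ _ i.2.1 _ i.2.2.1 _ i.2.2.2
  have hψ : ∀ i : I, ∃ φ ∈ N, ∀ f' ∈ 𝒞.F, ∀ o,
      ‖ℓ i.1.1 f' o i.1.2.1 (𝒯 i.1.2.1) i.1.2.2.2 - φ f' o‖ ≤ ε :=
    fun i => hN _ _ i.2.1 _ (h𝒯 _ i.2.1) _ i.2.2.2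
  choose φ hφN hφ using hφ
  choose ψ hψN hψ using hψ
  -- Cover elements need not be estimation functions, so each cell is represented by a tuple in it.
  -- The code also records the ball of ℓ(f, 𝒯f, v), because 𝒯 need not be continuous; hence the
  -- square of the covering number. Tuples with equal codes are 2ε-close in both functions.
  set c : I → Fin H × N × N := fun i => (i.1.1, ⟨φ i, hφN i⟩, ⟨ψ i, hψN i⟩)
  have htri : ∀ {x y z : EuclideanSpace ℝ (Fin d)}, ‖x - z‖ ≤ ε → ‖y - z‖ ≤ ε →
      ‖x - y‖ ≤ 2 * ε := fun {x y z} hx hy => by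
    rw [norm_sub_rev y z] at hy
    have := norm_sub_le_norm_sub_add_norm_sub x z y
    linarith
  refine ⟨Finset.univ.image fun k => (Function.invFun c k).1, ?_, ?_, ?_⟩
  · refine Finset.card_image_le.trans (le_of_eq ?_)
    simp [sq]
  · intro i hi
    obtain ⟨k, -, rfl⟩ := Finset.mem_image.1 hi
    exact (Function.invFun c k).2
  · intro h f hf g hg v hv
    set i : I := ⟨(h, f, g, v), hf, hg, hv⟩
    have hk : c (Function.invFun c (c i)) = c i := Function.invFun_eq ⟨i, rfl⟩
    set j := Function.invFun c (c i)
    have hk1 : j.1.1 = h := congrArg Prod.fst hk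
    have hk2 : φ j = φ i := congrArg (fun p => p.2.1.1) hk
    have hk3 : ψ j = ψ i := congrArg (fun p => p.2.2.1) hk
    refine ⟨j.1, Finset.mem_image.2 ⟨c i, Finset.mem_univ _, rfl⟩, hk1, fun f' hf' o => ?_⟩
    have h1 := hφ i f' hf' o
    have h2 := hφ j f' hf' o
    have h3 := hψ i f' hf' o
    have h4 := hψ j f' hf' o
    rw [hk1, hk2] at h2
    rw [hk1, hk3] at h4
    exact ⟨htri h1 h2, htri h3 h4⟩

end Covering

/-! ### Uniform concentration -/

theorem abs_sq_norm_sub_sq_norm_le {E : Type*} [SeminormedAddCommGroup E] {x y : E} {R ε : ℝ}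
    (hx : ‖x‖ ≤ R) (hy : ‖y‖ ≤ R) (hxy : ‖x - y‖ ≤ ε) : |‖x‖ ^ 2 - ‖y‖ ^ 2| ≤ 2 * R * ε := by
  have h1 : ‖x‖ ^ 2 - ‖y‖ ^ 2 = (‖x‖ + ‖y‖) * (‖x‖ - ‖y‖) := by ring
  rw [h1, abs_mul, abs_of_nonneg (by positivity)]
  exact mul_le_mul (by linarith) ((abs_norm_sub_norm_le x y).trans hxy) (abs_nonneg _)
    (by linarith [norm_nonneg x])

section Uniform

variable {S A Hyp : Type*} [MeasurableSpace S] [MeasurableSpace A] [MeasurableSpace Hyp]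
  {H d : ℕ} {M : MDP S A H} {𝒞 : HypClasses S A Hyp H} {𝒱 : Set (S × A × S → ℝ)} {fstar : Hyp}
  {ℓ : EstFun S A Hyp H d} {R : ℝ}

theorem avgSqCondMean_nonneg (h : Fin H) (f' f g : Hyp) (v : S × A × S → ℝ) :
    0 ≤ avgSqCondMean M 𝒞 ℓ h f' f g v := integral_nonneg fun _ => sq_nonneg _

theorem IsDEF.integrable_sq_norm_condMean (hdef : IsDEF M 𝒞 𝒱 fstar ℓ R) {h : Fin H}
    {f' f g : Hyp} (hf' : f' ∈ 𝒞.F) (hf : f ∈ 𝒞.F) (hg : g ∈ 𝒞.G)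
    {v : S × A × S → ℝ} (hv : v ∈ 𝒱) :
    Integrable (fun x : Fin (H + 1) → S =>
      ‖condMean M ℓ h f' f g v (x h.castSucc) ((𝒞.greedy f').act h (x h.castSucc))‖ ^ 2)
      (M.episodeLaw (𝒞.greedy f')) := by
  have hm : Measurable fun s => ‖condMean M ℓ h f' f g v s ((𝒞.greedy f').act h s)‖ ^ 2 :=
    (((hdef.measurable_condMean_greedy hf hg hv).comp
      (measurable_prodMk_left (x := (⟨f', hf'⟩ : 𝒞.F)))).norm).pow_const 2
  refine Integrable.of_bound (hm.comp (measurable_pi_apply _)).aestronglyMeasurable (R ^ 2)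
    (ae_of_all _ fun x => ?_)
  rw [norm_pow, norm_norm]
  exact pow_le_pow_left₀ (norm_nonneg _) (hdef.norm_condMean_le hf hg hv hf' _ _) 2

theorem IsDEF.integrable (hdef : IsDEF M 𝒞 𝒱 fstar ℓ R) (h : Fin H)
    {f' f g : Hyp} (hf' : f' ∈ 𝒞.F) (hf : f ∈ 𝒞.F) (hg : g ∈ 𝒞.G)
    {v : S × A × S → ℝ} (hv : v ∈ 𝒱) (s : S) (a : A) :
    Integrable (fun s' => ℓ h f' (s, a, s') f g v) (M.trans h (s, a)) := by
  have hm := (hdef.measurable h f hf g hg v hv).comp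
    ((measurable_prodMk_left (x := (⟨f', hf'⟩ : 𝒞.F))).comp
      ((measurable_prodMk_left (x := s)).comp (measurable_prodMk_left (x := a))))
  exact Integrable.of_bound hm.aestronglyMeasurable R
    (ae_of_all _ fun _ => hdef.bounded h f' hf' f hf g hg v hv _)

/-- Conditional means inherit the sup-norm distance of the estimation functions, and squaring the
norm is 2R-Lipschitz on the ball of radius R. -/
theorem IsDEF.avgSqCondMean_le_add (hdef : IsDEF M 𝒞 𝒱 fstar ℓ R) {h : Fin H} {ε : ℝ}
    {f' f g f₂ g₂ : Hyp} (hf' : f' ∈ 𝒞.F) (hf : f ∈ 𝒞.F) (hg : g ∈ 𝒞.G) (hf₂ : f₂ ∈ 𝒞.F)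
    (hg₂ : g₂ ∈ 𝒞.G) {v v₂ : S × A × S → ℝ} (hv : v ∈ 𝒱) (hv₂ : v₂ ∈ 𝒱)
    (hclose : ∀ o, ‖ℓ h f' o f g v - ℓ h f' o f₂ g₂ v₂‖ ≤ ε) :
    avgSqCondMean M 𝒞 ℓ h f' f g v ≤ avgSqCondMean M 𝒞 ℓ h f' f₂ g₂ v₂ + 2 * R * ε := by
  have hi := hdef.integrable_sq_norm_condMean (h := h) hf' hf₂ hg₂ hv₂
  have hle := integral_mono (hdef.integrable_sq_norm_condMean (h := h) hf' hf hg hv)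
    (hi.add (integrable_const (2 * R * ε))) (fun x => by
      have hcm : ‖condMean M ℓ h f' f g v (x h.castSucc) ((𝒞.greedy f').act h (x h.castSucc))
          - condMean M ℓ h f' f₂ g₂ v₂ (x h.castSucc)
            ((𝒞.greedy f').act h (x h.castSucc))‖ ≤ ε := by
        rw [condMean, condMean, ← integral_sub (hdef.integrable h hf' hf hg hv _ _)
          (hdef.integrable h hf' hf₂ hg₂ hv₂ _ _)]
        exact (norm_integral_le_of_norm_le_const (ae_of_all _ fun _ => hclose _)).trans (by simp)
      have := (abs_le.1 (abs_sq_norm_sub_sq_norm_le (hdef.norm_condMean_le hf hg hv hf' _ _)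
        (hdef.norm_condMean_le hf₂ hg₂ hv₂ hf' _ _) hcm)).2
      change _ ≤ ‖_‖ ^ 2 + 2 * R * ε
      linarith)
  refine hle.trans (le_of_eq ?_)
  refine (integral_add hi (integrable_const _)).trans ?_
  simp [avgSqCondMean]

/-- Uniform concentration along a run of OPERA: with high probability, all mean squared errors are
controlled by the excess losses. -/
theorem IsOperaRun.measure_exists_excess_le [NeZero H] (hdef : IsDEF M 𝒞 𝒱 fstar ℓ R) (hR : 0 < R)
    {Ω : Type*} {mΩ : MeasurableSpace Ω} {μ : Measure Ω} [IsProbabilityMeasure μ]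
    {ℱ : Filtration ℕ mΩ} {fs : ℕ → Ω → Hyp} {x : ℕ → Ω → Fin (H + 1) → S} {β : ℝ} {T : ℕ}
    (hT : 0 < T) (hrun : IsOperaRun M 𝒞 𝒱 ℓ β T μ ℱ fs x)
    {𝒯 : Hyp → Hyp} (h𝒯 : ∀ f ∈ 𝒞.F, 𝒯 f ∈ 𝒞.G)
    (hdec : ∀ h, ∀ f ∈ 𝒞.F, ∀ f' ∈ 𝒞.F, ∀ g ∈ 𝒞.G, ∀ v ∈ 𝒱, ∀ s a, ∀ᵐ s' ∂(M.trans h (s, a)),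
      ℓ h f' (s, a, s') f g v - condMean M ℓ h f' f g v s a = ℓ h f' (s, a, s') f (𝒯 f) v)
    {N : Finset (Hyp → S × A × S → EuclideanSpace ℝ (Fin d))}
    (hN : ∀ h, ∀ f ∈ 𝒞.F, ∀ g ∈ 𝒞.G, ∀ v ∈ 𝒱, ∃ φ ∈ N, ∀ f' ∈ 𝒞.F, ∀ o,
        ‖ℓ h f' o f g v - φ f' o‖ ≤ 1 / (T : ℝ)) (hN0 : 0 < N.card)
    {δ : ℝ} (hδ : 0 < δ) (hδ1 : δ < 1) :
    μ {ω | ¬ ∀ h, ∀ f ∈ 𝒞.F, ∀ g ∈ 𝒞.G, ∀ v ∈ 𝒱, ∀ t < T,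
      ∑ i ∈ Finset.range t, avgSqCondMean M 𝒞 ℓ h (fs i ω) f g v
        ≤ 4 * (∑ i ∈ Finset.range t,
            ‖ℓ h (fs i ω) (obs (𝒞.greedy (fs i ω)) (x i ω) h) f g v‖ ^ 2
          - ∑ i ∈ Finset.range t,
            ‖ℓ h (fs i ω) (obs (𝒞.greedy (fs i ω)) (x i ω) h) f (𝒯 f) v‖ ^ 2
          + (8 * R ^ 2 * Real.log (T * H * N.card / δ) + 9 * R))} ≤ ENNReal.ofReal δ := by
  obtain ⟨s, hscard, hs, hrep⟩ := exists_representatives hN h𝒯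
  set ι := Real.log (T * H * N.card / δ) with hι
  have hH : 0 < H := Nat.pos_of_ne_zero (NeZero.ne H)
  have hTr : (0 : ℝ) < T := by exact_mod_cast hT
  have hHr : (0 : ℝ) < H := by exact_mod_cast hH
  have hNr : (0 : ℝ) < N.card := by exact_mod_cast hN0
  -- The threshold is 2ι because there are up to T·H·N² events: their total probability is at most
  -- THN²·(δ/(THN))² ≤ δ.
  set bad : (Fin H × Hyp × Hyp × (S × A × S → ℝ)) × ℕ → Set Ω := fun p =>
    {ω | 2 * ι ≤ ∑ i ∈ Finset.range p.2,
      (-(1 / (4 * R ^ 2)) *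
        (‖ℓ p.1.1 (fs i ω) (obs (𝒞.greedy (fs i ω)) (x i ω) p.1.1) p.1.2.1 p.1.2.2.1
            p.1.2.2.2‖ ^ 2
          - ‖ℓ p.1.1 (fs i ω) (obs (𝒞.greedy (fs i ω)) (x i ω) p.1.1) p.1.2.1 (𝒯 p.1.2.1)
            p.1.2.2.2‖ ^ 2)
        + 1 / (16 * R ^ 2) *
          avgSqCondMean M 𝒞 ℓ p.1.1 (fs i ω) p.1.2.1 p.1.2.2.1 p.1.2.2.2)} with hbad
  have hbadμ : ∀ p ∈ s ×ˢ Finset.range T, μ (bad p) ≤ ENNReal.ofReal (Real.exp (-(2 * ι))) := by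
    rintro ⟨i, t⟩ hp
    obtain ⟨hi, ht⟩ := Finset.mem_product.1 hp
    obtain ⟨h1, h2, h3⟩ := hs i hi
    exact hrun.measure_excess_le hdef hR h1 h2 (h𝒯 _ h1) h3
      (fun f' hf' => hdec _ _ h1 f' hf' _ h2 _ h3) (Finset.mem_range.1 ht).le _
  have hunion : μ (⋃ p ∈ s ×ˢ Finset.range T, bad p) ≤ ENNReal.ofReal δ := by
    refine (measure_biUnion_finset_le _ _).trans ((Finset.sum_le_sum hbadμ).trans ?_)
    rw [Finset.sum_const, nsmul_eq_mul, ← ENNReal.ofReal_natCast,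
      ← ENNReal.ofReal_mul (Nat.cast_nonneg _)]
    refine ENNReal.ofReal_le_ofReal ?_
    have hexp : Real.exp (-(2 * ι)) = (δ / (T * H * N.card)) ^ 2 := by
      rw [show -(2 * ι) = -ι + -ι by ring, Real.exp_add, Real.exp_neg, hι,
        Real.exp_log (by positivity), inv_div, sq]
    have hcard : (((s ×ˢ Finset.range T).card : ℕ) : ℝ) ≤ T * H * N.card ^ 2 := by
      rw [Finset.card_product, Finset.card_range]
      have : s.card * T ≤ H * N.card ^ 2 * T := Nat.mul_le_mul_right _ hscard
      calc ((s.card * T : ℕ) : ℝ) ≤ ((H * N.card ^ 2 * T : ℕ) : ℝ) := by exact_mod_cast this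
        _ = T * H * N.card ^ 2 := by push_cast; ring
    rw [hexp]
    have hTH : (1 : ℝ) ≤ T * H := by exact_mod_cast Nat.mul_pos hT hH
    calc (((s ×ˢ Finset.range T).card : ℕ) : ℝ) * (δ / (T * H * N.card)) ^ 2
        ≤ (T * H * N.card ^ 2) * (δ / (T * H * N.card)) ^ 2 :=
          mul_le_mul_of_nonneg_right hcard (sq_nonneg _)
      _ = δ * (δ / (T * H)) := by field_simp
      _ ≤ δ * 1 := by
          refine mul_le_mul_of_nonneg_left ?_ hδ.le
          rw [div_le_one (by positivity)]
          linarith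
      _ = δ := mul_one δ
  refine (measure_mono ?_).trans hunion
  intro ω hω
  by_contra hgood
  refine hω fun h f hf g hg v hv t ht => ?_
  obtain ⟨i, hi, rfl, hclose⟩ := hrep h f hf g hg v hv
  obtain ⟨h1, h2, h3⟩ := hs i hi
  have hnot : ω ∉ bad (i, t) := fun hmem => hgood (Set.mem_biUnion
    (show ((i, t) : _ × ℕ) ∈ ((s ×ˢ Finset.range T : Finset _) : Set _) from
      Finset.mem_coe.2 (Finset.mem_product.2 ⟨hi, Finset.mem_range.2 ht⟩)) hmem)
  simp only [hbad, Set.mem_ofPred_eq, not_le] at hnot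
  rw [Finset.sum_add_distrib, ← Finset.mul_sum, ← Finset.mul_sum, Finset.sum_sub_distrib] at hnot
  have hmem : ∀ j ∈ Finset.range t, fs j ω ∈ 𝒞.F := fun j hj =>
    hrun.mem j ((Finset.mem_range.1 hj).trans ht) ω
  set X₁ := ∑ j ∈ Finset.range t,
    ‖ℓ i.1 (fs j ω) (obs (𝒞.greedy (fs j ω)) (x j ω) i.1) i.2.1 i.2.2.1 i.2.2.2‖ ^ 2
  set X₂ := ∑ j ∈ Finset.range t,
    ‖ℓ i.1 (fs j ω) (obs (𝒞.greedy (fs j ω)) (x j ω) i.1) i.2.1 (𝒯 i.2.1) i.2.2.2‖ ^ 2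
  set m := ∑ j ∈ Finset.range t, avgSqCondMean M 𝒞 ℓ i.1 (fs j ω) i.2.1 i.2.2.1 i.2.2.2
  -- Each of the t < T summands moves by at most 2R·(2/T) when the tuple is replaced by its
  -- representative, so each sum moves by at most 4R.
  have htT : ∀ c : ℝ, 0 ≤ c → (t : ℝ) * (c * (2 * (1 / T))) ≤ 2 * c := fun c hc => by
    have : (t : ℝ) / T ≤ 1 := by
      rw [div_le_one hTr]
      exact_mod_cast ht.le
    calc (t : ℝ) * (c * (2 * (1 / T))) = (t / T) * (2 * c) := by ring
      _ ≤ 1 * (2 * c) := mul_le_mul_of_nonneg_right this (by positivity)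
      _ = 2 * c := one_mul _
  have hm : ∑ j ∈ Finset.range t, avgSqCondMean M 𝒞 ℓ i.1 (fs j ω) f g v ≤ m + 4 * R := by
    have : ∑ j ∈ Finset.range t, avgSqCondMean M 𝒞 ℓ i.1 (fs j ω) f g v
        ≤ ∑ j ∈ Finset.range t, (avgSqCondMean M 𝒞 ℓ i.1 (fs j ω) i.2.1 i.2.2.1 i.2.2.2
          + 2 * R * (2 * (1 / T))) := Finset.sum_le_sum fun j hj =>
      hdef.avgSqCondMean_le_add (hmem j hj) hf hg h1 h2 hv h3
        (fun o => (hclose _ (hmem j hj) o).1)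
    rw [Finset.sum_add_distrib, Finset.sum_const, Finset.card_range, nsmul_eq_mul] at this
    linarith [htT (2 * R) (by positivity)]
  have hX₁ : X₁ ≤ ∑ j ∈ Finset.range t,
      ‖ℓ i.1 (fs j ω) (obs (𝒞.greedy (fs j ω)) (x j ω) i.1) f g v‖ ^ 2 + 4 * R := by
    have : X₁ ≤ ∑ j ∈ Finset.range t,
        (‖ℓ i.1 (fs j ω) (obs (𝒞.greedy (fs j ω)) (x j ω) i.1) f g v‖ ^ 2
          + 2 * R * (2 * (1 / T))) := Finset.sum_le_sum fun j hj => by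
      have := (abs_le.1 (abs_sq_norm_sub_sq_norm_le
        (hdef.bounded i.1 _ (hmem j hj) _ hf _ hg _ hv (obs (𝒞.greedy (fs j ω)) (x j ω) i.1))
        (hdef.bounded i.1 _ (hmem j hj) _ h1 _ h2 _ h3 _)
        (hclose _ (hmem j hj) _).1)).1
      linarith
    rw [Finset.sum_add_distrib, Finset.sum_const, Finset.card_range, nsmul_eq_mul] at this
    linarith [htT (2 * R) (by positivity)]
  have hX₂ : ∑ j ∈ Finset.range t,
      ‖ℓ i.1 (fs j ω) (obs (𝒞.greedy (fs j ω)) (x j ω) i.1) f (𝒯 f) v‖ ^ 2 ≤ X₂ + 4 * R := by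
    have : ∑ j ∈ Finset.range t,
        ‖ℓ i.1 (fs j ω) (obs (𝒞.greedy (fs j ω)) (x j ω) i.1) f (𝒯 f) v‖ ^ 2
        ≤ ∑ j ∈ Finset.range t,
        (‖ℓ i.1 (fs j ω) (obs (𝒞.greedy (fs j ω)) (x j ω) i.1) i.2.1 (𝒯 i.2.1) i.2.2.2‖ ^ 2
          + 2 * R * (2 * (1 / T))) := Finset.sum_le_sum fun j hj => by
      have := (abs_le.1 (abs_sq_norm_sub_sq_norm_le
        (hdef.bounded i.1 _ (hmem j hj) _ hf _ (h𝒯 _ hf) _ hv (obs (𝒞.greedy (fs j ω)) (x j ω) i.1))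
        (hdef.bounded i.1 _ (hmem j hj) _ h1 _ (h𝒯 _ h1) _ h3 _)
        (hclose _ (hmem j hj) _).2)).2
      linarith
    rw [Finset.sum_add_distrib, Finset.sum_const, Finset.card_range, nsmul_eq_mul] at this
    linarith [htT (2 * R) (by positivity)]
  have hmX : m ≤ 4 * (X₁ - X₂) + 32 * R ^ 2 * ι := by
    have h16 := mul_le_mul_of_nonneg_left hnot.le (show (0 : ℝ) ≤ 16 * R ^ 2 by positivity)
    have e1 : 16 * R ^ 2 * (-(1 / (4 * R ^ 2)) * (X₁ - X₂) + 1 / (16 * R ^ 2) * m)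
        = -4 * (X₁ - X₂) + m := by
      field_simp
      ring
    rw [e1] at h16
    linarith
  -- The replacement errors add up to 4R + 4·(4R + 4R) = 4·9R.
  linarith

end Uniform

/-! ### Regret on the good event -/

theorem le_toNat_feDim {Hyp : Type*} {H : ℕ} {Gc : Fin H → Hyp → Hyp → ℝ} {F : Set Hyp} {ε : ℝ}
    (hdim : feDim F Gc ε ≠ ⊤) (h : Fin H) {n : ℕ}
    (hn : IsEluderLength F (Gc h) ε n) : n ≤ (feDim F Gc ε).toNat := by
  have h1 : (n : ℕ∞) ≤ feDim F Gc ε :=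
    le_iSup_of_le h (le_iSup_of_le n (le_iSup_of_le hn le_rfl))
  rw [← ENat.natCast_toNat hdim] at h1
  exact_mod_cast h1

section Eluder

variable {S A Hyp : Type*} [MeasurableSpace S] [MeasurableSpace A] [MeasurableSpace Hyp]
  {H d : ℕ} {M : MDP S A H} {𝒞 : HypClasses S A Hyp H} {𝒱 : Set (S × A × S → ℝ)} {fstar : Hyp}
  {ℓ : EstFun S A Hyp H d} {R : ℝ} {Gc : Fin H → Hyp → Hyp → ℝ} {κ : ℝ}

/-- The coupling function is dominated by the mean squared error at the global discriminator. -/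
theorem IsABC.sq_le_avgSqCondMean (habc : IsABC M 𝒞 𝒱 ℓ Gc κ) (hdef : IsDEF M 𝒞 𝒱 fstar ℓ R)
    {h : Fin H} {f g : Hyp} (hf : f ∈ 𝒞.F) (hg : g ∈ 𝒞.F) {v : S × A × S → ℝ} (hv : v ∈ 𝒱)
    (hmax : ∀ f' ∈ 𝒞.F, ∀ w ∈ 𝒱, ∀ s a,
      ‖condMean M ℓ h f' f f w s a‖ ≤ ‖condMean M ℓ h f' f f v s a‖) :
    (Gc h f g) ^ 2 ≤ avgSqCondMean M 𝒞 ℓ h g f f v := by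
  have : Nonempty 𝒱 := ⟨⟨v, hv⟩⟩
  refine (habc.dominating h f hf g hg).trans (ciSup_le fun w => ?_)
  exact integral_mono (hdef.integrable_sq_norm_condMean hg hf (𝒞.subset hf) w.2)
    (hdef.integrable_sq_norm_condMean hg hf (𝒞.subset hf) hv)
    fun x => pow_le_pow_left₀ (norm_nonneg _) (hmax g hg w w.2 _ _) 2

/-- Single-episode regret in terms of the coupling functions. -/
theorem IsABC.optValue_sub_value_le [NeZero H] (habc : IsABC M 𝒞 𝒱 ℓ Gc κ) (hκ : 0 < κ)
    (hint : 𝒞.IntegrableValues M) (hstar : 𝒞.IsOptimalHyp M fstar) {f : Hyp} (hf : f ∈ 𝒞.F)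
    (hopt : 𝒞.Q fstar 0 M.init ((𝒞.greedy fstar).act 0 M.init)
      ≤ 𝒞.Q f 0 M.init ((𝒞.greedy f).act 0 M.init)) :
    M.optValue 0 M.init - M.value (𝒞.greedy f) 0 M.init ≤ ∑ h, |Gc h f f| / κ := by
  have hH : 0 < H := Nat.pos_of_ne_zero (NeZero.ne H)
  have hV : 𝒞.V fstar 0 M.init ≤ 𝒞.V f 0 M.init := by
    rw [HypClasses.V, HypClasses.V, dif_pos hH, dif_pos hH]
    exact hopt
  have h1 := HypClasses.optValue_le_V hstar
  have h2 := HypClasses.V_sub_value_eq_sum hint hf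
  refine (by linarith : _ ≤ 𝒞.V f 0 M.init - M.value (𝒞.greedy f) 0 M.init).trans ?_
  rw [h2]
  refine Finset.sum_le_sum fun h _ => (le_abs_self _).trans ?_
  rw [le_div_iff₀ hκ, mul_comm]
  exact habc.bellman_dominance h f hf

/-- The regret bound on the event where the mean squared errors are controlled by the excess
losses. -/
theorem regret_le_of_excess_le [NeZero H] (habc : IsABC M 𝒞 𝒱 ℓ Gc κ) (hκ : 0 < κ)
    (hdef : IsDEF M 𝒞 𝒱 fstar ℓ R) (hR : 0 < R)
    (hint : 𝒞.IntegrableValues M) (hstar : 𝒞.IsOptimalHyp M fstar)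
    {𝒯 : Hyp → Hyp} (h𝒯 : ∀ f ∈ 𝒞.F, 𝒯 f ∈ 𝒞.G) (h𝒯star : 𝒯 fstar = fstar)
    {T : ℕ} {w β b : ℝ} (hw : 0 < w) (hb : b ≤ β) (hβ : 0 < β)
    (hdim : feDim 𝒞.F Gc w ≠ ⊤)
    {fs : ℕ → Hyp} {xs : ℕ → Fin (H + 1) → S} (hmem : ∀ t < T, fs t ∈ 𝒞.F)
    (hopt : ∀ t < T, (confidenceSet 𝒞 𝒱 ℓ β fs xs t).Nonempty →
      fs t ∈ confidenceSet 𝒞 𝒱 ℓ β fs xs t ∧ ∀ f' ∈ confidenceSet 𝒞 𝒱 ℓ β fs xs t,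
        𝒞.Q f' 0 M.init ((𝒞.greedy f').act 0 M.init)
          ≤ 𝒞.Q (fs t) 0 M.init ((𝒞.greedy (fs t)).act 0 M.init))
    (hgood : ∀ h, ∀ f ∈ 𝒞.F, ∀ g ∈ 𝒞.G, ∀ v ∈ 𝒱, ∀ t < T,
      ∑ i ∈ Finset.range t, avgSqCondMean M 𝒞 ℓ h (fs i) f g v
        ≤ 4 * (∑ i ∈ Finset.range t, ‖ℓ h (fs i) (obs (𝒞.greedy (fs i)) (xs i) h) f g v‖ ^ 2
          - ∑ i ∈ Finset.range t,
            ‖ℓ h (fs i) (obs (𝒞.greedy (fs i)) (xs i) h) f (𝒯 f) v‖ ^ 2 + b)) :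
    regret M 𝒞 T fs ≤ (H : ℝ) / κ * (T * w + (min T (feDim 𝒞.F Gc w).toNat : ℕ) * R
      + 2 * √(8 * β * (feDim 𝒞.F Gc w).toNat) * √T) := by
  have hfstar := hstar.1
  have : Nonempty 𝒞.G := ⟨⟨fstar, 𝒞.subset hfstar⟩⟩
  have hstar_mem : ∀ t < T, fstar ∈ confidenceSet 𝒞 𝒱 ℓ β fs xs t := by
    intro t ht
    refine ⟨hfstar, fun h v hv => ?_⟩
    rw [sub_le_comm]
    refine le_ciInf fun g => ?_
    -- As 𝒯 fstar = fstar, a nonnegative left side says that the loss of fstar exceeds that of any g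
    -- by at most b ≤ β.
    have h1 := hgood h fstar hfstar g g.2 v hv t ht
    have h2 : 0 ≤ ∑ i ∈ Finset.range t, avgSqCondMean M 𝒞 ℓ h (fs i) fstar g v :=
      Finset.sum_nonneg fun _ _ => avgSqCondMean_nonneg _ _ _ _ _
    rw [h𝒯star] at h1
    linarith
  -- One discriminator must serve the whole past: the good event bounds a sum over i for a fixed v,
  -- while dominance has a separate supremum for each i.
  have hdisc : ∀ t < T, ∀ h, ∃ v ∈ 𝒱,
      (∀ f' ∈ 𝒞.F, (Gc h (fs t) f') ^ 2 ≤ avgSqCondMean M 𝒞 ℓ h f' (fs t) (fs t) v) := by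
    intro t ht h
    obtain ⟨v, hv, hmax⟩ := hdef.global_discriminator (fs t) (hmem t ht) h
    exact ⟨v, hv, fun f' hf' => habc.sq_le_avgSqCondMean hdef (hmem t ht) hf' hv hmax⟩
  have hsum : ∀ h, ∀ t < T, ∑ i ∈ Finset.range t, (Gc h (fs t) (fs i)) ^ 2 ≤ 8 * β := by
    intro h t ht
    obtain ⟨v, hv, hG⟩ := hdisc t ht h
    have hF := hmem t ht
    have hconf := ((hopt t ht ⟨fstar, hstar_mem t ht⟩).1.2 h v hv)
    have hinf : ⨅ g : 𝒞.G, ∑ i ∈ Finset.range t,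
        ‖ℓ h (fs i) (obs (𝒞.greedy (fs i)) (xs i) h) (fs t) g v‖ ^ 2
        ≤ ∑ i ∈ Finset.range t,
          ‖ℓ h (fs i) (obs (𝒞.greedy (fs i)) (xs i) h) (fs t) (𝒯 (fs t)) v‖ ^ 2 :=
      ciInf_le ⟨0, by
        rintro _ ⟨g, rfl⟩
        exact Finset.sum_nonneg fun _ _ => sq_nonneg _⟩ (⟨𝒯 (fs t), h𝒯 _ hF⟩ : 𝒞.G)
    have h1 := hgood h (fs t) hF (fs t) (𝒞.subset hF) v hv t ht
    refine (Finset.sum_le_sum fun i hi =>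
      hG (fs i) (hmem i ((Finset.mem_range.1 hi).trans ht))).trans (h1.trans ?_)
    -- The constraint bounds the excess over 𝒯 (fs t) by β, so the sum is at most 4(β + b) ≤ 8β.
    linarith
  have hdiag : ∀ h, ∀ t < T, |Gc h (fs t) (fs t)| ≤ R := by
    intro h t ht
    obtain ⟨v, hv, hG⟩ := hdisc t ht h
    have hF := hmem t ht
    exact abs_le_of_sq_le_sq ((hG _ hF).trans (hdef.avgSqCondMean_le hF (𝒞.subset hF) hv hF)) hR.le
  have hreg : regret M 𝒞 T fs ≤ ∑ t ∈ Finset.range T, ∑ h, |Gc h (fs t) (fs t)| / κ := by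
    refine Finset.sum_le_sum fun t ht => ?_
    have ht' := Finset.mem_range.1 ht
    have hs := hstar_mem t ht'
    exact habc.optValue_sub_value_le hκ hint hstar (hmem t ht') ((hopt t ht' ⟨_, hs⟩).2 _ hs)
  refine hreg.trans ?_
  rw [Finset.sum_comm]
  have hbound : ∀ h : Fin H, ∑ t ∈ Finset.range T, |Gc h (fs t) (fs t)| / κ
      ≤ (T * w + (min T (feDim 𝒞.F Gc w).toNat : ℕ) * R
        + 2 * √(8 * β * (feDim 𝒞.F Gc w).toNat) * √T) / κ := by
    intro h
    rw [← Finset.sum_div]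
    exact div_le_div_of_nonneg_right (sum_abs_le_of_isEluderLength
      (fun n hn => le_toNat_feDim hdim h hn) hw (by linarith) fs T hmem (hdiag h) (hsum h)) hκ.le
  refine (Finset.sum_le_sum fun h _ => hbound h).trans (le_of_eq ?_)
  rw [Finset.sum_const, Finset.card_univ, Fintype.card_fin, nsmul_eq_mul]
  ring

end Eluder

/-! ### Constants and conclusion -/

/-- The first two terms are at most √(Td)(1 + R), using d ≥ 1 and min(T, d) ≤ √(Td). The lower bound
on β then absorbs them into √(Tdβ). -/
theorem add_le_mul_sqrt_of_le {T d : ℕ} {R β c : ℝ} (hT : 0 < T) (hd : 0 < d) (hR : 0 < R)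
    (hc : 0 < c) (hcβ : c / 2 ≤ β) :
    T * √(1 / (T : ℝ)) + (min T d : ℕ) * R + 2 * √(8 * β * d) * √T
      ≤ ((1 + R) / √(c / 2) + 2 * √8) * √((T : ℝ) * d * β) := by
  have hTr : (0 : ℝ) < T := by exact_mod_cast hT
  have hd1 : (1 : ℝ) ≤ d := by exact_mod_cast hd
  have hβ : 0 < β := by linarith
  have hc0 : 0 < √(c / 2) := Real.sqrt_pos.2 (by linarith)
  have h1 : T * √(1 / (T : ℝ)) ≤ √((T : ℝ) * d) := by
    rw [Real.sqrt_div zero_le_one, Real.sqrt_one, mul_one_div, Real.div_sqrt]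
    exact Real.sqrt_le_sqrt (by nlinarith)
  have h2 : ((min T d : ℕ) : ℝ) * R ≤ √((T : ℝ) * d) * R := by
    refine mul_le_mul_of_nonneg_right (Real.le_sqrt_of_sq_le ?_) hR.le
    rw [sq]
    exact mul_le_mul (by exact_mod_cast min_le_left T d) (by exact_mod_cast min_le_right T d)
      (Nat.cast_nonneg _) hTr.le
  have h3 : √(8 * β * d) * √T = √8 * √((T : ℝ) * d * β) := by
    rw [← Real.sqrt_mul (by positivity), ← Real.sqrt_mul (by norm_num)]
    ring_nf
  have h4 : √((T : ℝ) * d) ≤ √((T : ℝ) * d * β) / √(c / 2) := by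
    rw [le_div_iff₀ hc0, Real.sqrt_mul (by positivity) β]
    exact mul_le_mul_of_nonneg_left (Real.sqrt_le_sqrt hcβ) (Real.sqrt_nonneg _)
  have h5 := mul_le_mul_of_nonneg_left h4 (show (0 : ℝ) ≤ 1 + R by positivity)
  have h6 : ((1 + R) / √(c / 2) + 2 * √8) * √((T : ℝ) * d * β)
      = (1 + R) * (√((T : ℝ) * d * β) / √(c / 2)) + 2 * (√8 * √((T : ℝ) * d * β)) := by ring
  rw [h6, ← h3]
  linarith

theorem theorem1 (R : ℝ) (hR : 0 < R) :
    ∃ c₀ C : ℝ, 0 < c₀ ∧ 0 < C ∧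
      ∀ {S A Hyp Ω : Type*} [MeasurableSpace S] [MeasurableSpace A] [MeasurableSpace Hyp]
        {mΩ : MeasurableSpace Ω} (μ : Measure Ω) [IsProbabilityMeasure μ]
        (H d T : ℕ) [NeZero H] (_hT : 2 ≤ T)
        (M : MDP S A H) (_hM : M.Normalized)
        (𝒞 : HypClasses S A Hyp H) (_hint : 𝒞.IntegrableValues M)
        (fstar : Hyp) (_hstar : 𝒞.IsOptimalHyp M fstar)
        (𝒱 : Set (S × A × S → ℝ)) (ℓ : EstFun S A Hyp H d)
        (_hdef : IsDEF M 𝒞 𝒱 fstar ℓ R)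
        (ρ : Hyp → Hyp → ℝ) (L : ℝ) (_hL : 0 < L) (_hlip : IsLipschitzEst 𝒞 𝒱 ρ ℓ L)
        (Gc : Fin H → Hyp → Hyp → ℝ) (κ : ℝ) (_hκ : 0 < κ) (_hκ1 : κ ≤ 1)
        (_habc : IsABC M 𝒞 𝒱 ℓ Gc κ)
        (_hdim : feDim 𝒞.F Gc (Real.sqrt (1 / (T : ℝ))) ≠ ⊤)
        (_hcov : coveringNumberEst 𝒞 𝒱 ℓ (1 / (T : ℝ)) ≠ ⊤)
        (δ : ℝ) (_hδ : 0 < δ) (_hδ1 : δ < 1)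
        (β : ℝ) (_hβ : c₀ * Real.log
          ((T : ℝ) * H * ((coveringNumberEst 𝒞 𝒱 ℓ (1 / (T : ℝ))).toNat : ℝ) / δ) ≤ β)
        (ℱ : Filtration ℕ mΩ) (f : ℕ → Ω → Hyp) (x : ℕ → Ω → Fin (H + 1) → S)
        (_hrun : IsOperaRun M 𝒞 𝒱 ℓ β T μ ℱ f x),
        μ {ω | C * ((H : ℝ) / κ * Real.sqrt
              ((T : ℝ) * ((feDim 𝒞.F Gc (Real.sqrt (1 / (T : ℝ)))).toNat : ℝ) * β))
            < regret M 𝒞 T (fun t => f t ω)}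
          ≤ ENNReal.ofReal δ := by

  have hc₀ : 0 < 8 * R ^ 2 + 18 * R := by positivity
  -- The good event needs β ≥ 8R²ι + 9R. Since ι ≥ log 2 > 1/2, the constant 9R is at most 18Rι,
  -- which gives c₀.
  refine ⟨8 * R ^ 2 + 18 * R, (1 + R) / √((8 * R ^ 2 + 18 * R) / 2) + 2 * √8, hc₀,
    by positivity, ?_⟩
  intro S A Hyp Ω _ _ _ mΩ μ _ H d T _ hT M _ 𝒞 hint fstar hstar 𝒱 ℓ hdef _ _ _ _ Gc κ hκ _ habc
    hdim hcov δ hδ hδ1 β hβ ℱ f x hrun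
  have hT0 : 0 < T := by omega
  have hH : 0 < H := Nat.pos_of_ne_zero (NeZero.ne H)
  obtain ⟨N, hNcard, hN⟩ := exists_finset_cover hcov
  obtain ⟨𝒯, h𝒯, h𝒯star, hdec⟩ := hdef.decomposable
  rw [← hNcard] at hβ
  have hN0 : 0 < N.card := by
    obtain ⟨v, hv, -⟩ := hdef.global_discriminator fstar hstar.1 0
    obtain ⟨φ, hφ, -⟩ := hN 0 fstar hstar.1 fstar (𝒞.subset hstar.1) v hv
    exact Finset.card_pos.2 ⟨φ, hφ⟩
  set ι := Real.log (T * H * N.card / δ) with hι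
  have hι2 : 1 / 2 ≤ ι := by
    have h2 : (2 : ℝ) ≤ T * H * N.card / δ := by
      rw [le_div_iff₀ hδ]
      have : (2 : ℝ) ≤ T * H * N.card := by
        have : 2 * 1 * 1 ≤ T * H * N.card := Nat.mul_le_mul (Nat.mul_le_mul hT hH) hN0
        exact_mod_cast this
      linarith
    have := Real.log_le_log (by norm_num) h2
    linarith [Real.log_two_gt_d9]
  have hβ2 : (8 * R ^ 2 + 18 * R) / 2 ≤ β := by nlinarith
  have hb : 8 * R ^ 2 * ι + 9 * R ≤ β := by nlinarith
  set D := (feDim 𝒞.F Gc √(1 / (T : ℝ))).toNat with hD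
  -- A sequence of length one is an eluder sequence vacuously, as the condition starts at the second
  -- element.
  have hD0 : 0 < D := le_toNat_feDim hdim 0 (n := 1)
    ⟨fun _ => fstar, fun _ => hstar.1, _, le_rfl, fun t ht => absurd t.2 (by omega)⟩
  have hopt : ∀ᵐ ω ∂μ, ∀ t < T,
      (confidenceSet 𝒞 𝒱 ℓ β (fun i => f i ω) (fun i => x i ω) t).Nonempty →
      f t ω ∈ confidenceSet 𝒞 𝒱 ℓ β (fun i => f i ω) (fun i => x i ω) t ∧
      ∀ f' ∈ confidenceSet 𝒞 𝒱 ℓ β (fun i => f i ω) (fun i => x i ω) t,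
        𝒞.Q f' 0 M.init ((𝒞.greedy f').act 0 M.init)
          ≤ 𝒞.Q (f t ω) 0 M.init ((𝒞.greedy (f t ω)).act 0 M.init) := by
    rw [ae_all_iff]
    intro t
    by_cases ht : t < T
    · filter_upwards [hrun.optimal t ht] with ω hω _ using hω
    · exact ae_of_all _ fun ω h => absurd h ht
  -- Outside the null set where the selection rule fails, large regret forces uniform concentration
  -- to fail.
  refine le_trans (measure_mono_ae ?_)
    (hrun.measure_exists_excess_le hdef hR hT0 h𝒯 hdec hN hN0 hδ hδ1)
  filter_upwards [hopt] with ω hω hlarge hgood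
  have hreg := regret_le_of_excess_le habc hκ hdef hR hint hstar h𝒯 h𝒯star
    (w := √(1 / (T : ℝ))) (Real.sqrt_pos.2 (by positivity)) hb (by linarith) hdim
    (fun t ht => hrun.mem t ht ω) hω hgood
  have hconst := add_le_mul_sqrt_of_le (T := T) hT0 hD0 hR hc₀ hβ2
  have hmul := mul_le_mul_of_nonneg_left hconst (show (0 : ℝ) ≤ H / κ by positivity)
  have hlarge' : ((1 + R) / √((8 * R ^ 2 + 18 * R) / 2) + 2 * √8)
      * ((H : ℝ) / κ * √((T : ℝ) * D * β)) < regret M 𝒞 T (fun t => f t ω) := hlarge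
  linarith
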